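/- Let $\varepsilon,R\in\mathbb{R}$ with $R\ge 0$ and $\hat R:=(R^2+\tfrac14\varepsilon^2)^{1/2}>0$. Let ${\cal W}={\cal W}(\varepsilon)$ be the unital complex algebra generated by $a_+,a_-,b_+,b_-$ with relations $[a_-,a_+]=\varepsilon$, $[b_-,b_+]=\varepsilon$ and every $a_\pm$ commuting with every $b_\pm$. Let $\dagger$ be the conjugate-linear anti-automorphism of ${\cal W}$ with $a_\pm^\dagger=a_\mp$, $b_\pm^\dagger=b_\mp$. Put $J_-=a_-b_+$, $K_0=\tfrac12(a_+a_-+b_+b_-+\varepsilon)$ and $\mathrm{Ad}_T(w)=Tw-wT$. Every $w\in{\cal W}$ can be written uniquely as a totally symmetric noncommutative polynomial in $a_+,a_-,b_+,b_-$. Its formal trace is the sum $w_1+w_2+w_3+w_4$ of the left cofactors in $w=w_1a_+a_-+w_2a_-a_++w_3b_+b_-+w_4b_-b_++\cdots$, where the terms of this symmetric expression are collected according to their last two letters. Let $\Psi\subset{\cal W}$ be the space of elements with zero formal trace, let $\rho:{\cal W}\to\Psi$ be the projection onto $\Psi$ with kernel $\{w(K_0-\hat R)\mid w\in{\cal W}\}$,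 let $\pi_0(w)\in\mathbb{C}$ be the constant term of the totally symmetric expression of $w$, and put $$\langle\xi,\zeta\rangle=\pi_0(\rho(\xi^\dagger\zeta)),\qquad \|\zeta\|^2=\langle\zeta,\zeta\rangle .$$ Let $n,r,m$ satisfy $2n,\,n+r,\,n+m\in\mathbb{Z}$, $n\ge0$, $|r|\le n$, $|m|\le n$, and let $$P(n,r,m)=\varepsilon^{m-n}\left(\frac{(n+m)!}{(2n)!\,(n-m)!}\right)^{1/2}(\mathrm{Ad}_{J_-})^{n-m}\bigl(a_+^{n+r}b_-^{n-r}\bigr),$$ where for $\varepsilon=0$ the operator $\varepsilon^{-1}\mathrm{Ad}_{J_-}$ is replaced by its limit, the derivation $b_+\,\partial/\partial a_+-a_-\,\partial/\partial b_-$. Then $\|P(n,r,m)\|^2$ is real and $$\|P(n,r,m)\|^2=\pi_0\bigl(\rho(a_-^{n+r}a_+^{n+r}b_+^{n-r}b_-^{n-r})\bigr)=\frac{(n+r)!\,(n-r)!}{(2n+1)!}\prod_{s=1}^{n-r}(2\hat R-\varepsilon s)\prod_{s=1}^{n+r}(2\hat R+\varepsilon s).$$ In particular it is independent of $m$. Moreover,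 with the convention $2\hat R/\varepsilon=+\infty$ for $\varepsilon=0$, $$\mathrm{sign}\,\|P(n,r,m)\|^2=\begin{cases}1&\text{if }2\hat R/\varepsilon>n-r,\\ 0&\text{if }2\hat R/\varepsilon\in\mathbb{Z},\ 1\le 2\hat R/\varepsilon\le n-r,\\ (-1)^{\,n-r-\lfloor 2\hat R/\varepsilon\rfloor}&\text{if }2\hat R/\varepsilon\notin\mathbb{Z},\ 0<2\hat R/\varepsilon<n-r.\end{cases}$$ (For $\varepsilon<0$ only the formula for $\|P(n,r,m)\|^2$ is asserted.) -/

import Mathlib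

noncomputable section

namespace JordanSchwinger

/-- The four generators `a₊, a₋, b₊, b₋`. -/
inductive Gen where
  | ap | am | bp | bm

/-- The action of conjugation on generators: `a₊ ↔ a₋`, `b₊ ↔ b₋`. -/
def Gen.conj : Gen → Gen
  | .ap => .am
  | .am => .ap
  | .bp => .bm
  | .bm => .bp

/-! ### The algebra `W(ε)` -/

/-- The defining relations of `W(ε)`: `[a₋, a₊] = ε`, `[b₋, b₊] = ε`, and every `a` commutes
with every `b`. -/
inductive Rel (ε : ℝ) : FreeAlgebra ℂ Gen → FreeAlgebra ℂ Gen → Prop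
  | a : Rel ε (FreeAlgebra.ι ℂ Gen.am * FreeAlgebra.ι ℂ Gen.ap
        - FreeAlgebra.ι ℂ Gen.ap * FreeAlgebra.ι ℂ Gen.am) (algebraMap ℂ _ (ε : ℂ))
  | b : Rel ε (FreeAlgebra.ι ℂ Gen.bm * FreeAlgebra.ι ℂ Gen.bp
        - FreeAlgebra.ι ℂ Gen.bp * FreeAlgebra.ι ℂ Gen.bm) (algebraMap ℂ _ (ε : ℂ))
  | apbp : Rel ε (FreeAlgebra.ι ℂ Gen.ap * FreeAlgebra.ι ℂ Gen.bp)
        (FreeAlgebra.ι ℂ Gen.bp * FreeAlgebra.ι ℂ Gen.ap)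
  | apbm : Rel ε (FreeAlgebra.ι ℂ Gen.ap * FreeAlgebra.ι ℂ Gen.bm)
        (FreeAlgebra.ι ℂ Gen.bm * FreeAlgebra.ι ℂ Gen.ap)
  | ambp : Rel ε (FreeAlgebra.ι ℂ Gen.am * FreeAlgebra.ι ℂ Gen.bp)
        (FreeAlgebra.ι ℂ Gen.bp * FreeAlgebra.ι ℂ Gen.am)
  | ambm : Rel ε (FreeAlgebra.ι ℂ Gen.am * FreeAlgebra.ι ℂ Gen.bm)
        (FreeAlgebra.ι ℂ Gen.bm * FreeAlgebra.ι ℂ Gen.am)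

/-- The algebra `W(ε)`: the free complex algebra on `a₊, a₋, b₊, b₋` modulo the relations. -/
def W (ε : ℝ) : Type := RingQuot (Rel ε)

instance (ε : ℝ) : Ring (W ε) := inferInstanceAs (Ring (RingQuot (Rel ε)))

instance (ε : ℝ) : Algebra ℂ (W ε) := inferInstanceAs (Algebra ℂ (RingQuot (Rel ε)))

/-- The quotient map from the free algebra to `W(ε)`. -/
def mk (ε : ℝ) : FreeAlgebra ℂ Gen →ₐ[ℂ] W ε := RingQuot.mkAlgHom ℂ (Rel ε)

theorem mk_surjective (ε : ℝ) : Function.Surjective (mk ε) :=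
  RingQuot.mkAlgHom_surjective ℂ (Rel ε)

theorem mk_rel {ε : ℝ} {x y : FreeAlgebra ℂ Gen} (h : Rel ε x y) : mk ε x = mk ε y :=
  RingQuot.mkAlgHom_rel ℂ h

/-- The universal property of the quotient `W(ε)`. -/
def lift {A : Type} [Ring A] [Algebra ℂ A] (ε : ℝ) (f : FreeAlgebra ℂ Gen →ₐ[ℂ] A)
    (hf : ∀ ⦃x y⦄, Rel ε x y → f x = f y) : W ε →ₐ[ℂ] A :=
  RingQuot.liftAlgHom ℂ ⟨f, hf⟩

theorem lift_mk {A : Type} [Ring A] [Algebra ℂ A] (ε : ℝ) (f : FreeAlgebra ℂ Gen →ₐ[ℂ] A)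
    (hf : ∀ ⦃x y⦄, Rel ε x y → f x = f y) (x : FreeAlgebra ℂ Gen) :
    lift ε f hf (mk ε x) = f x :=
  RingQuot.liftAlgHom_mkAlgHom_apply ℂ f hf x

/-- The image of a generator in `W(ε)`. -/
def gen (ε : ℝ) (g : Gen) : W ε := mk ε (FreeAlgebra.ι ℂ g)

/-- `a₊` -/
abbrev ap (ε : ℝ) : W ε := gen ε Gen.ap
/-- `a₋` -/
abbrev am (ε : ℝ) : W ε := gen ε Gen.am
/-- `b₊` -/
abbrev bp (ε : ℝ) : W ε := gen ε Gen.bp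
/-- `b₋` -/
abbrev bm (ε : ℝ) : W ε := gen ε Gen.bm

theorem am_ap (ε : ℝ) : am ε * ap ε - ap ε * am ε = algebraMap ℂ (W ε) (ε : ℂ) := by
  simpa [gen] using mk_rel (Rel.a (ε := ε))

theorem bm_bp (ε : ℝ) : bm ε * bp ε - bp ε * bm ε = algebraMap ℂ (W ε) (ε : ℂ) := by
  simpa [gen] using mk_rel (Rel.b (ε := ε))

theorem ap_bp (ε : ℝ) : ap ε * bp ε = bp ε * ap ε := by
  simpa [gen] using mk_rel (Rel.apbp (ε := ε))

theorem ap_bm (ε : ℝ) : ap ε * bm ε = bm ε * ap ε := by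
  simpa [gen] using mk_rel (Rel.apbm (ε := ε))

theorem am_bp (ε : ℝ) : am ε * bp ε = bp ε * am ε := by
  simpa [gen] using mk_rel (Rel.ambp (ε := ε))

theorem am_bm (ε : ℝ) : am ε * bm ε = bm ε * am ε := by
  simpa [gen] using mk_rel (Rel.ambm (ε := ε))

/-- `J₋ = a₋ b₊` -/
def Jm (ε : ℝ) : W ε := am ε * bp ε

/-- `K₀ = ½ (a₊ a₋ + b₊ b₋ + ε)` -/
def K0 (ε : ℝ) : W ε :=
  (1 / 2 : ℂ) • (ap ε * am ε + bp ε * bm ε + algebraMap ℂ (W ε) (ε : ℂ))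

/-- The adjoint action `Ad_T w = [T, w] = T w - w T`. -/
def Ad (ε : ℝ) (T : W ε) : W ε →ₗ[ℂ] W ε :=
  LinearMap.mulLeft ℂ T - LinearMap.mulRight ℂ T

/-! ### Conjugation -/

/-- The opposite ring of `W(ε)`, with scalars acting through complex conjugation. It only serves
to construct the conjugate-linear antiautomorphism `dagger`. -/
def ConjOp (ε : ℝ) : Type := (W ε)ᵐᵒᵖ

instance (ε : ℝ) : Ring (ConjOp ε) := inferInstanceAs (Ring (W ε)ᵐᵒᵖ)

instance (ε : ℝ) : Algebra ℂ (ConjOp ε) :=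
  RingHom.toAlgebra' ((algebraMap ℂ (W ε)ᵐᵒᵖ).comp (starRingEnd ℂ))
    (fun c x => Algebra.commutes (A := (W ε)ᵐᵒᵖ) (starRingEnd ℂ c) x)

/-- A generator, conjugated, as an element of `ConjOp`. -/
def genOp (ε : ℝ) (g : Gen) : ConjOp ε := MulOpposite.op (gen ε g.conj)

theorem algebraMap_conjOp (ε : ℝ) (c : ℂ) : algebraMap ℂ (ConjOp ε) c
    = MulOpposite.op (algebraMap ℂ (W ε) (starRingEnd ℂ c)) := rfl

/-- Conjugation as a homomorphism of complex algebras from `W(ε)` to `ConjOp`. -/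
def daggerHom (ε : ℝ) : W ε →ₐ[ℂ] ConjOp ε :=
  lift ε (FreeAlgebra.lift ℂ (genOp ε)) <| by
    intro x y h
    cases h <;> simp only [map_sub, map_mul, FreeAlgebra.lift_ι_apply, AlgHom.commutes,
      algebraMap_conjOp, Complex.conj_ofReal]
    · exact congrArg MulOpposite.op (am_ap ε)
    · exact congrArg MulOpposite.op (bm_bp ε)
    · exact congrArg MulOpposite.op (am_bm ε).symm
    · exact congrArg MulOpposite.op (am_bp ε).symm
    · exact congrArg MulOpposite.op (ap_bm ε).symm
    · exact congrArg MulOpposite.op (ap_bp ε).symm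

/-- Conjugation `w ↦ w†` on `W(ε)`. -/
def dagger (ε : ℝ) (w : W ε) : W ε := MulOpposite.unop (α := W ε) (daggerHom ε w)

theorem dagger_gen (ε : ℝ) (g : Gen) : dagger ε (gen ε g) = gen ε g.conj := by
  simp only [dagger, daggerHom, gen, lift_mk,
    FreeAlgebra.lift_ι_apply]
  rfl

theorem dagger_add (ε : ℝ) (v w : W ε) : dagger ε (v + w) = dagger ε v + dagger ε w := by
  unfold dagger; rw [map_add]; rfl

theorem dagger_mul (ε : ℝ) (v w : W ε) : dagger ε (v * w) = dagger ε w * dagger ε v := by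
  unfold dagger; rw [map_mul]; rfl

theorem dagger_algebraMap (ε : ℝ) (c : ℂ) :
    dagger ε (algebraMap ℂ (W ε) c) = algebraMap ℂ (W ε) (starRingEnd ℂ c) := by
  unfold dagger; rw [AlgHom.commutes]; rfl

/-! ### Symmetric polynomials and the formal trace -/

/-- Noncommutative polynomials in the generators, by their coefficients on words. -/
abbrev WordPoly : Type := List Gen →₀ ℂ

/-- The value in `W(ε)` of a noncommutative polynomial. -/
def eval (ε : ℝ) : WordPoly →ₗ[ℂ] W ε :=
  Finsupp.linearCombination ℂ (fun l : List Gen => (l.map (gen ε)).prod)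

/-- The totally symmetric polynomials: the coefficient of a word does not change when the letters
of the word are permuted. Every element of `W(ε)` is the value of exactly one of them. -/
def Symm : Submodule ℂ WordPoly where
  carrier := {c | ∀ l l' : List Gen, l.Perm l' → c l = c l'}
  add_mem' := by
    intro c d hc hd l l' h
    simp [hc l l' h, hd l l' h]
  zero_mem' := by
    intro l l' _
    rfl
  smul_mem' := by
    intro z c hc l l' h
    simp [hc l l' h]

/-- The left cofactor of the final two letters `x y`: the words of `c` ending in `x y`, with
these two letters removed. -/
def cofactor (x y : Gen) : WordPoly →ₗ[ℂ] WordPoly :=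
  Finsupp.lcomapDomain (fun l : List Gen => l ++ [x, y]) (List.append_left_injective [x, y])

theorem cofactor_apply (x y : Gen) (c : WordPoly) (l : List Gen) :
    cofactor x y c l = c (l ++ [x, y]) := rfl

/-- The formal trace: the sum of the cofactors of `a₊a₋`, `a₋a₊`, `b₊b₋` and `b₋b₊`. -/
def formalTrace : WordPoly →ₗ[ℂ] WordPoly :=
  cofactor .ap .am + cofactor .am .ap + cofactor .bp .bm + cofactor .bm .bp

/-- `Ψ`: the elements of `W(ε)` given by formally traceless totally symmetric polynomials. -/
def Psi (ε : ℝ) : Submodule ℂ (W ε) :=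
  Submodule.map (eval ε) (Symm ⊓ LinearMap.ker formalTrace)

/-- The totally symmetric expression of an element of `W(ε)`. -/
def symmExpr (ε : ℝ) (w : W ε) : WordPoly :=
  Function.invFunOn (eval ε) (Symm : Set WordPoly) w

/-- The projection `π₀` onto the component of degree zero, `ℂ · 1` being identified with `ℂ`: the
constant term of the totally symmetric expression. -/
def pi0 (ε : ℝ) (w : W ε) : ℂ := symmExpr ε w []

/-! ### The projection `ρ` and the sesquilinear form -/

/-- `R̂ = (R² + ε² / 4)^(1/2)` -/
def Rhat (ε R : ℝ) : ℝ := Real.sqrt (R ^ 2 + ε ^ 2 / 4)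

/-- The kernel of `ρ`: the left ideal `{w (K₀ - R̂) | w ∈ W(ε)}`. -/
def kerRho (ε R : ℝ) : Submodule ℂ (W ε) :=
  LinearMap.range (LinearMap.mulRight ℂ (K0 ε - algebraMap ℂ (W ε) (Rhat ε R : ℂ)))

open Classical in
/-- The projection `ρ` of `W(ε)` onto `Ψ` with kernel `kerRho`. The two subspaces are complementary
whenever `R̂ > 0`; the value `0` in the other branch is not used. -/
def rho (ε R : ℝ) : W ε →ₗ[ℂ] W ε :=
  if h : IsCompl (Psi ε) (kerRho ε R) then
    (Psi ε).subtype ∘ₗ Submodule.projectionOnto (Psi ε) (kerRho ε R) h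
  else 0

/-- The sesquilinear form `⟨ξ, ζ⟩ = π₀(ρ(ξ† ζ))`. -/
def form (ε R : ℝ) (ξ ζ : W ε) : ℂ := pi0 ε (rho ε R (dagger ε ξ * ζ))

/-- The real number `‖ζ‖²`; the theorem also states that `⟨ζ, ζ⟩` is real for the elements `ζ`
it is about. -/
def normSq (ε R : ℝ) (ζ : W ε) : ℝ := (form ε R ζ ζ).re

/-! ### The basis elements `P(n, r, m)` -/

/-- The values of the derivation `b₊ ∂/∂a₊ - a₋ ∂/∂b₋` on the generators. -/
def derGen (ε : ℝ) : Gen → W ε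
  | .ap => bp ε
  | .am => 0
  | .bp => 0
  | .bm => -am ε

/-- `w ↦ w + D w`, as a homomorphism to the square-zero extension of `W(ε)` by itself. -/
def derHom (ε : ℝ) : W ε →ₐ[ℂ] TrivSqZeroExt (W ε) (W ε) :=
  lift ε (FreeAlgebra.lift ℂ (fun g =>
      TrivSqZeroExt.inl (gen ε g) + TrivSqZeroExt.inr (derGen ε g))) <| by
    intro x y h
    have h1 := am_ap ε
    have h2 := bm_bp ε
    have h3 := ap_bp ε
    have h4 := ap_bm ε
    have h5 := am_bp ε
    have h6 := am_bm ε
    cases h <;> simp only [map_sub, map_mul, FreeAlgebra.lift_ι_apply, AlgHom.commutes] <;>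
      refine TrivSqZeroExt.ext ?_ ?_ <;>
      simp [derGen, TrivSqZeroExt.algebraMap_eq_inl', add_comm, *]
    have h7 := sub_eq_zero.2 (h1.trans h2.symm)
    rw [← sub_eq_zero, ← h7]
    abel

/-- The derivation `D = b₊ ∂/∂a₊ - a₋ ∂/∂b₋` of `W(ε)`. It satisfies `ε D = Ad_{J₋}` for all `ε`
(see `smul_der`), and for `ε = 0` it is the limit of `ε⁻¹ Ad_{J₋}`. -/
def der (ε : ℝ) : W ε →ₗ[ℂ] W ε where
  toFun w := (derHom ε w).snd
  map_add' v w := by simp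
  map_smul' z w := by simp

theorem derHom_fst (ε : ℝ) (w : W ε) : (derHom ε w).fst = w := by
  obtain ⟨x, rfl⟩ := mk_surjective ε w
  have h : ((TrivSqZeroExt.fstHom ℂ (W ε) (W ε)).comp (derHom ε)).comp (mk ε) = mk ε :=
    FreeAlgebra.hom_ext (funext fun g => by simp [derHom, gen, lift_mk])
  exact DFunLike.congr_fun h x

theorem der_gen (ε : ℝ) (g : Gen) : der ε (gen ε g) = derGen ε g := by
  simp [der, derHom, gen, lift_mk]

theorem der_mul (ε : ℝ) (v w : W ε) : der ε (v * w) = v * der ε w + der ε v * w := by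
  simp [der, derHom_fst]

theorem der_algebraMap (ε : ℝ) (c : ℂ) : der ε (algebraMap ℂ (W ε) c) = 0 := by
  change (derHom ε (algebraMap ℂ (W ε) c)).snd = 0
  rw [AlgHom.commutes]
  simp [TrivSqZeroExt.algebraMap_eq_inl']

theorem smul_der (ε : ℝ) (w : W ε) : (ε : ℂ) • der ε w = Ad ε (Jm ε) w := by
  obtain ⟨x, rfl⟩ := mk_surjective ε w
  have key : ∀ w : W ε, Ad ε (Jm ε) w = Jm ε * w - w * Jm ε := fun w => rfl
  induction x using FreeAlgebra.induction with
  | grade0 c =>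
    rw [AlgHom.commutes, der_algebraMap, key, Algebra.commutes]
    simp
  | grade1 g =>
    change (ε : ℂ) • der ε (gen ε g) = Ad ε (Jm ε) (gen ε g)
    rw [der_gen, key, Jm]
    have h1 := am_ap ε
    have h2 := bm_bp ε
    have h3 := ap_bp ε
    have h4 := ap_bm ε
    have h5 := am_bp ε
    have h6 := am_bm ε
    rw [sub_eq_iff_eq_add] at h1 h2
    cases g <;> simp only [derGen, Algebra.smul_def]
    · rw [mul_assoc, ← h3, ← mul_assoc, h1]
      noncomm_ring
    · rw [mul_assoc, ← h5]
      noncomm_ring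
    · rw [← mul_assoc (bp ε), ← h5]
      noncomm_ring
    · rw [← mul_assoc, ← h6, mul_assoc (am ε) (bm ε), h2, Algebra.commutes]
      simp [mul_add, mul_assoc]
  | mul v w hv hw =>
    rw [map_mul, der_mul, smul_add, ← mul_smul_comm, ← smul_mul_assoc, hv, hw, key, key, key]
    noncomm_ring
  | add v w hv hw =>
    rw [map_add, map_add, map_add, smul_add, hv, hw]

/-- For `n, r, m` with `2n, n + r, n + m ∈ ℤ`, `|r| ≤ n`, `|m| ≤ n`, the element
`P(n,r,m) = ε^(m-n) ((n+m)! / ((2n)! (n-m)!))^(1/2) (Ad_{J₋})^(n-m) (a₊^(n+r) b₋^(n-r))`,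
where for `ε = 0` the operator `ε⁻¹ Ad_{J₋}` is replaced by its limit. All arguments of `⌊·⌋₊`
are natural numbers. -/
def P (ε n r m : ℝ) : W ε :=
  ((Real.sqrt ((⌊n + m⌋₊.factorial : ℝ) /
      ((⌊2 * n⌋₊.factorial : ℝ) * (⌊n - m⌋₊.factorial : ℝ))) : ℝ) : ℂ) •
    if ε = 0 then
      (der ε ^ ⌊n - m⌋₊) (ap ε ^ ⌊n + r⌋₊ * bm ε ^ ⌊n - r⌋₊)
    else
      (((ε ^ ⌊n - m⌋₊)⁻¹ : ℝ) : ℂ) •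
        (Ad ε (Jm ε) ^ ⌊n - m⌋₊) (ap ε ^ ⌊n + r⌋₊ * bm ε ^ ⌊n - r⌋₊)

end JordanSchwinger

end

/-!
The idea is to transport everything to commutative polynomials by the Weyl symbol. The algebra
`W(ε)` acts on polynomials in four commuting variables by left Moyal multiplication (`moyal`), a
generator `g` acting as `X g ± (ε/2) ∂/∂g†`. The symbol of `w` is the value of `w` at `1`. On a
totally symmetric expression the derivative terms cancel, so that the symbol is the commutative
image of the expression (`symbol_eval`); as symmetrizing a word changes its value only by shorter
words, the symbol is a linear isomorphism. It turns `π₀` into the constant coefficient (`pi0_eq`),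
the elements with zero formal trace into the harmonic polynomials for `∂a₊∂a₋ + ∂b₊∂b₋`
(`mem_Psi_iff`), and right multiplication by `K₀ - R̂` into half the multiplication by
`Q = a₊a₋ + b₊b₋` plus terms that do not raise the degree. Because `Δ Q` is bijective in each
degree, `Δ` composed with this right multiplication is bijective too, whence `Ψ` and the left
ideal are complementary (`isCompl_Psi_kerRho`) and `ρ` is a true projection.

The functional `φ = π₀ ∘ ρ` then has three properties: `φ 1 = 1`, it vanishes on the left ideal of
`K₀ - R̂`, and it vanishes on the image of the derivation `a₊ ∂/∂b₊ - b₋ ∂/∂a₋` (`phi_raise`), since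
that derivation commutes with `Δ`, kills `K₀` and creates no constant terms. The last two
properties, applied to `a₋^p a₊^p b₊^q b₋^q` and to `a₋^(p+1) a₊^p b₊^(q+1) b₋^q`, are two linear
relations between the values of `φ` at the elements `a₋^p a₊^p b₊^q b₋^q` with neighbouring `p, q`;
solved as a recursion they give the closed formula (`phi_diagElt`).

Finally, for every `ε` the element `P(n, r, m)` is a multiple of `D^(n-m) (a₊^(n+r) b₋^(n-r))` for
the derivation `D = b₊ ∂/∂a₊ - a₋ ∂/∂b₋`. The raising derivation is adjoint to `D` with respect to
the form, again by `phi_raise`, and together they satisfy the relations of `sl₂`, with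
`a₊^p b₋^q` as a highest weight vector. So each application of `D` multiplies the norm by the usual
factor (`phi_der_pow_topElt`), which the normalization of `P(n, r, m)` cancels. The signs are read
off from the factors `2R̂ - εs`.
-/

noncomputable section

namespace JordanSchwinger

/-! ### Commutative symbols of symmetric words -/

instance : DecidableEq Gen := fun x y => by
  cases x <;> cases y <;> first | exact isTrue rfl | exact isFalse (by intro h; cases h)

instance : Fintype Gen where
  elems := {.ap, .am, .bp, .bm}
  complete x := by cases x <;> simp

theorem sum_gen {M : Type*} [AddCommMonoid M] (f : Gen → M) :
    ∑ g, f g = f .ap + (f .am + (f .bp + f .bm)) := by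
  change ∑ g ∈ ({.ap, .am, .bp, .bm} : Finset Gen), f g = _
  rw [Finset.sum_insert (by simp), Finset.sum_insert (by simp), Finset.sum_insert (by simp),
    Finset.sum_singleton]

/-- Commutative polynomials in the four generators, which serve as symbols of elements of
`W(ε)`. -/
abbrev Poly : Type := MvPolynomial Gen ℂ

open MvPolynomial

/-- The commutative image of a noncommutative polynomial. -/
def abel : WordPoly →ₗ[ℂ] Poly :=
  Finsupp.linearCombination ℂ (fun l : List Gen => (l.map (X : Gen → Poly)).prod)

/-- The right cofactor of the first letter `g`: the words of `c` beginning with `g`, with this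
letter removed. -/
def tail (g : Gen) : WordPoly →ₗ[ℂ] WordPoly :=
  Finsupp.lcomapDomain (List.cons g) (List.cons_injective)

theorem tail_apply (g : Gen) (c : WordPoly) (l : List Gen) : tail g c l = c (g :: l) := rfl

/-- On symmetric words this is the partial derivative with respect to `g`: remove a leading `g`,
and multiply by the number of positions at which it could have been. -/
def wordDeriv (g : Gen) (c : WordPoly) : WordPoly :=
  (fun l : List Gen => ((l.length : ℂ) + 1)) • tail g c

theorem wordDeriv_apply (g : Gen) (c : WordPoly) (l : List Gen) :
    wordDeriv g c l = ((l.length : ℂ) + 1) * c (g :: l) := rfl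

/-- The noncommutative polynomials in words of length less than `N`. -/
def lenLT (N : ℕ) (c : WordPoly) : Prop := ∀ l : List Gen, N ≤ l.length → c l = 0

theorem exists_lenLT (c : WordPoly) : ∃ N, lenLT N c := by
  refine ⟨c.support.sup List.length + 1, fun l hl => ?_⟩
  by_contra h
  have := Finset.le_sup (f := List.length) (Finsupp.mem_support_iff.2 h)
  omega

theorem eq_zero_of_lenLT_zero {c : WordPoly} (h : lenLT 0 c) : c = 0 :=
  Finsupp.ext fun l => h l (Nat.zero_le _)

theorem lenLT.tail {N : ℕ} {c : WordPoly} (h : lenLT (N + 1) c) (g : Gen) :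
    lenLT N (tail g c) := fun l hl => h (g :: l) (by simpa using hl)

theorem lenLT.wordDeriv {N : ℕ} {c : WordPoly} (h : lenLT (N + 1) c) (g : Gen) :
    lenLT N (wordDeriv g c) := fun l hl => by
  rw [wordDeriv_apply, h (g :: l) (by simpa using hl), mul_zero]

theorem tail_mem_symm {c : WordPoly} (h : c ∈ Symm) (g : Gen) : tail g c ∈ Symm :=
  fun _ _ hl => h _ _ (hl.cons g)

theorem wordDeriv_mem_symm {c : WordPoly} (h : c ∈ Symm) (g : Gen) : wordDeriv g c ∈ Symm :=
  fun l l' hl => by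
    rw [wordDeriv_apply, wordDeriv_apply, hl.length_eq, h _ _ (hl.cons g)]

/-- Left multiplication of words by the letter `g`. -/
def consMap (g : Gen) : WordPoly →ₗ[ℂ] WordPoly := Finsupp.lmapDomain ℂ ℂ (List.cons g)

theorem consMap_apply_cons (g h : Gen) (c : WordPoly) (l : List Gen) :
    consMap g c (h :: l) = if g = h then c l else 0 := by
  split_ifs with e
  · subst e
    exact Finsupp.mapDomain_apply List.cons_injective c l
  · refine Finsupp.mapDomain_of_notMem_range c _ ?_
    rintro ⟨l', hl'⟩
    exact e (List.cons.inj hl').1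

theorem consMap_apply_nil (g : Gen) (c : WordPoly) : consMap g c [] = 0 := by
  refine Finsupp.mapDomain_of_notMem_range c _ ?_
  rintro ⟨l', hl'⟩
  exact List.cons_ne_nil _ _ hl'

/-- A noncommutative polynomial, split according to the first letters of its words. -/
theorem eq_sum_consMap (c : WordPoly) :
    c = Finsupp.single [] (c []) + ∑ g, consMap g (tail g c) := by
  ext l
  rw [Finsupp.add_apply, Finsupp.finsetSum_apply]
  cases l with
  | nil => simp [consMap_apply_nil]
  | cons h l => simp [consMap_apply_cons, tail_apply]

theorem eval_consMap (ε : ℝ) (g : Gen) (c : WordPoly) :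
    eval ε (consMap g c) = gen ε g * eval ε c := by
  induction c using Finsupp.induction_linear with
  | zero => simp
  | add c d hc hd => rw [map_add, map_add, hc, hd, map_add, mul_add]
  | single l z => simp [consMap, eval]

theorem abel_consMap (g : Gen) (c : WordPoly) : abel (consMap g c) = X g * abel c := by
  induction c using Finsupp.induction_linear with
  | zero => simp
  | add c d hc hd => rw [map_add, map_add, hc, hd, map_add, mul_add]
  | single l z => simp [consMap, abel]

theorem eval_eq_sum (ε : ℝ) (c : WordPoly) :
    eval ε c = algebraMap ℂ (W ε) (c []) + ∑ g, gen ε g * eval ε (tail g c) := by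
  conv_lhs => rw [eq_sum_consMap c]
  simp only [map_add, map_sum, eval_consMap]
  congr 1
  simp [eval, Algebra.algebraMap_eq_smul_one]

theorem abel_eq_sum (c : WordPoly) :
    abel c = C (c []) + ∑ g, X g * abel (tail g c) := by
  conv_lhs => rw [eq_sum_consMap c]
  simp only [map_add, map_sum, abel_consMap]
  congr 1
  simp [abel, MvPolynomial.smul_eq_C_mul]

theorem coeff_zero_abel (c : WordPoly) : constantCoeff (abel c) = c [] := by
  rw [abel_eq_sum]
  simp

theorem pderiv_X_mul (h g : Gen) (f : Poly) :
    pderiv h (X g * f) = X g * pderiv h f + if g = h then f else 0 := by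
  rw [Derivation.leibniz, smul_eq_mul, smul_eq_mul]
  split_ifs with e
  · subst e
    rw [pderiv_X_self, mul_one]
  · rw [pderiv_X_of_ne e, mul_zero]

/-- Both the operation `wordDeriv` and the partial derivative are computed by splitting off first
letters; the symmetry of `c` lets the letter `h` be moved to the front. -/
theorem pderiv_abel {c : WordPoly} (hc : c ∈ Symm) (h : Gen) :
    pderiv h (abel c) = abel (wordDeriv h c) := by
  obtain ⟨N, hN⟩ := exists_lenLT c
  induction N generalizing c with
  | zero =>
    have h0 : wordDeriv h 0 = 0 := Finsupp.ext fun l => by simp [wordDeriv_apply]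
    rw [eq_zero_of_lenLT_zero hN, h0, map_zero, map_zero]
  | succ N ih =>
    have key : ∀ g, tail g (wordDeriv h c) = wordDeriv h (tail g c) + tail g (tail h c) := by
      intro g
      ext l
      rw [Finsupp.add_apply]
      simp only [tail_apply, wordDeriv_apply]
      rw [hc (h :: g :: l) (g :: h :: l) (List.Perm.swap _ _ _), List.length_cons]
      push_cast
      ring
    rw [abel_eq_sum c, abel_eq_sum (wordDeriv h c)]
    simp only [map_add, map_sum, pderiv_X_mul, key, mul_add, Finset.sum_add_distrib, pderiv_C,
      ih (tail_mem_symm hc _) (hN.tail _)]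
    rw [Finset.sum_ite_eq' Finset.univ h, if_pos (Finset.mem_univ h), zero_add,
      abel_eq_sum (tail h c), wordDeriv_apply]
    simp only [List.length_nil, Nat.cast_zero, zero_add, one_mul, tail_apply]
    ring

/-- A symmetric noncommutative polynomial is determined by its commutative image: all its
`wordDeriv` vanish by induction on the length, and so does its constant term. -/
theorem abel_injOn_symm {c : WordPoly} (hc : c ∈ Symm) (h0 : abel c = 0) : c = 0 := by
  obtain ⟨N, hN⟩ := exists_lenLT c
  induction N generalizing c with
  | zero => exact eq_zero_of_lenLT_zero hN
  | succ N ih =>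
    ext l
    cases l with
    | nil => rw [← coeff_zero_abel, h0]; simp
    | cons g l =>
      have h1 : wordDeriv g c = 0 := by
        refine ih (wordDeriv_mem_symm hc g) ?_ (hN.wordDeriv g)
        rw [← pderiv_abel hc, h0, map_zero]
      have h2 := DFunLike.congr_fun h1 l
      rw [wordDeriv_apply] at h2
      exact (mul_eq_zero.1 h2).resolve_left (Nat.cast_add_one_ne_zero _)

/-! ### Symmetrization -/

/-- The symmetrization of a word: the average of its rearrangements. -/
def symWord (l : List Gen) : WordPoly :=
  ((l.permutations.toFinset.card : ℂ)⁻¹) •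
    ∑ l' ∈ l.permutations.toFinset, Finsupp.single l' 1

theorem card_permutations_ne_zero (l : List Gen) :
    (l.permutations.toFinset.card : ℂ) ≠ 0 := by
  rw [Nat.cast_ne_zero]
  exact Finset.card_ne_zero_of_mem (a := l) (by simp)

theorem symWord_apply (l l' : List Gen) : symWord l l' =
    (l.permutations.toFinset.card : ℂ)⁻¹ * if l'.Perm l then 1 else 0 := by
  rw [symWord, Finsupp.smul_apply, Finsupp.finsetSum_apply, smul_eq_mul]
  congr 1
  simp [Finsupp.single_apply]

theorem symWord_mem_symm (l : List Gen) : symWord l ∈ Symm := fun l₁ l₂ h => by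
  rw [symWord_apply, symWord_apply]
  congr 2
  exact propext ⟨fun h' => h.symm.trans h', fun h' => h.trans h'⟩

/-- Replacing a word by its symmetrization does not change a linear functional of it modulo a
subspace that contains the changes under rearrangements. -/
theorem linearCombination_symWord {M : Type*} [AddCommGroup M] [Module ℂ M] (f : List Gen → M)
    (l : List Gen) (S : Submodule ℂ M) (h : ∀ l', l'.Perm l → f l' - f l ∈ S) :
    Finsupp.linearCombination ℂ f (symWord l) - f l ∈ S := by
  have e : f l = (l.permutations.toFinset.card : ℂ)⁻¹ •
      ∑ l' ∈ l.permutations.toFinset, f l := by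
    rw [Finset.sum_const, ← Nat.cast_smul_eq_nsmul ℂ, smul_smul,
      inv_mul_cancel₀ (card_permutations_ne_zero l), one_smul]
  rw [e, symWord, map_smul, map_sum, ← smul_sub, ← Finset.sum_sub_distrib]
  refine S.smul_mem _ (S.sum_mem fun l' hl' => ?_)
  rw [Finsupp.linearCombination_single, one_smul]
  exact h l' (by simpa using hl')

theorem abel_symWord (l : List Gen) : abel (symWord l) = (l.map X).prod := by
  have := linearCombination_symWord (fun l : List Gen => (l.map (X : Gen → Poly)).prod) l ⊥
    (fun l' h => by rw [Submodule.mem_bot, sub_eq_zero]; exact (h.map _).prod_eq)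
  rw [Submodule.mem_bot, sub_eq_zero] at this
  exact this

theorem abel_surjOn_symm (f : Poly) : ∃ c ∈ Symm, abel c = f := by
  suffices h : (Submodule.map abel Symm) = ⊤ by
    have : f ∈ Submodule.map abel Symm := h ▸ Submodule.mem_top
    exact this
  rw [eq_top_iff]
  have h1 : ∀ l : List Gen, (l.map (X : Gen → Poly)).prod ∈ Submodule.map abel Symm :=
    fun l => ⟨symWord l, symWord_mem_symm l, abel_symWord l⟩
  rintro f -
  induction f using MvPolynomial.monomial_add_induction_on with
  | C a =>
    have := Submodule.smul_mem _ a (h1 [])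
    simpa [MvPolynomial.smul_eq_C_mul] using this
  | monomial_add μ b f _ _ hf =>
    refine Submodule.add_mem _ ?_ hf
    have e : monomial μ b = b • (((Finsupp.toMultiset μ).toList).map (X : Gen → Poly)).prod := by
      rw [← Multiset.prod_coe, ← Multiset.map_coe, Multiset.coe_toList, smul_eq_C_mul,
        monomial_eq, Finsupp.toMultiset_map, Finsupp.prod_toMultiset,
        Finsupp.prod_mapDomain_index (fun _ => pow_zero _) (fun _ _ _ => pow_add _ _ _)]
    rw [e]
    exact Submodule.smul_mem _ _ (h1 _)

/-- The subspace of `W(ε)` spanned by the words of length less than `N`. -/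
def shortWords (ε : ℝ) (N : ℕ) : Submodule ℂ (W ε) :=
  Submodule.span ℂ {w | ∃ l : List Gen, l.length < N ∧ (l.map (gen ε)).prod = w}

theorem gen_mul_mem_shortWords {ε : ℝ} {N : ℕ} (g : Gen) {w : W ε} (hw : w ∈ shortWords ε N) :
    gen ε g * w ∈ shortWords ε (N + 1) := by
  induction hw using Submodule.span_induction with
  | mem w h =>
    obtain ⟨l, hl, rfl⟩ := h
    exact Submodule.subset_span ⟨g :: l, by simpa using hl, by simp⟩
  | zero => simp
  | add v w _ _ hv hw => rw [mul_add]; exact Submodule.add_mem _ hv hw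
  | smul z w _ hw => rw [mul_smul_comm]; exact Submodule.smul_mem _ _ hw

theorem exists_commutator (ε : ℝ) (g h : Gen) :
    ∃ z : ℂ, gen ε g * gen ε h = gen ε h * gen ε g + algebraMap ℂ (W ε) z := by
  have h1 := sub_eq_iff_eq_add.1 (am_ap ε)
  have h2 := sub_eq_iff_eq_add.1 (bm_bp ε)
  cases g <;> cases h
  case ap.am => exact ⟨-ε, by rw [map_neg, h1]; abel⟩
  case am.ap => exact ⟨ε, by rw [h1]; abel⟩
  case bp.bm => exact ⟨-ε, by rw [map_neg, h2]; abel⟩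
  case bm.bp => exact ⟨ε, by rw [h2]; abel⟩
  all_goals
    refine ⟨0, ?_⟩
    rw [map_zero, add_zero]
  · exact ap_bp ε
  · exact ap_bm ε
  · exact am_bp ε
  · exact am_bm ε
  · exact (ap_bp ε).symm
  · exact (am_bp ε).symm
  · exact (ap_bm ε).symm
  · exact (am_bm ε).symm

/-- Rearranging a word changes its value in `W(ε)` only by shorter words, since commutators of
generators are scalars. -/
theorem perm_sub_mem_shortWords (ε : ℝ) {l l' : List Gen} (h : l.Perm l') :
    (l.map (gen ε)).prod - (l'.map (gen ε)).prod ∈ shortWords ε l.length := by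
  induction h with
  | nil => simp
  | cons g _ ih =>
    rw [List.map_cons, List.prod_cons, List.map_cons, List.prod_cons, ← mul_sub]
    exact gen_mul_mem_shortWords g ih
  | swap g h l =>
    obtain ⟨z, hz⟩ := exists_commutator ε h g
    simp only [List.map_cons, List.prod_cons, ← mul_assoc]
    rw [← sub_mul, hz, add_sub_cancel_left, ← Algebra.smul_def]
    exact Submodule.smul_mem _ _ (Submodule.subset_span ⟨l, by simp, rfl⟩)
  | trans h₁ h₂ ih₁ ih₂ =>
    rw [← h₁.length_eq] at ih₂
    simpa using Submodule.add_mem _ ih₁ ih₂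

theorem eval_symWord_sub_mem (ε : ℝ) (l : List Gen) :
    eval ε (symWord l) - (l.map (gen ε)).prod ∈ shortWords ε l.length :=
  linearCombination_symWord (fun l : List Gen => (l.map (gen ε)).prod) l _
    fun _ h => h.length_eq ▸ perm_sub_mem_shortWords ε h

/-- Symmetrizing a word changes its value in `W(ε)` only by shorter words. -/
theorem shortWords_le_eval_symm (ε : ℝ) (N : ℕ) :
    shortWords ε N ≤ Submodule.map (eval ε) Symm := by
  induction N with
  | zero => exact Submodule.span_le.2 fun w ⟨l, hl, _⟩ => absurd hl (Nat.not_lt_zero _)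
  | succ N ih =>
    refine Submodule.span_le.2 ?_
    rintro _ ⟨l, hl, rfl⟩
    have h1 : shortWords ε l.length ≤ shortWords ε N :=
      Submodule.span_mono fun w ⟨l', h, e⟩ => ⟨l', by omega, e⟩
    have h2 := ih (h1 (eval_symWord_sub_mem ε l))
    have h3 : eval ε (symWord l) ∈ Submodule.map (eval ε) Symm := ⟨_, symWord_mem_symm l, rfl⟩
    simpa using Submodule.sub_mem _ h3 h2

theorem eval_surjective (ε : ℝ) : Function.Surjective (eval ε) := by
  intro w
  obtain ⟨x, rfl⟩ := mk_surjective ε w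
  suffices h : ∀ x : FreeAlgebra ℂ Gen, ∀ w ∈ LinearMap.range (eval ε),
      mk ε x * w ∈ LinearMap.range (eval ε) by
    have h1 : (1 : W ε) ∈ LinearMap.range (eval ε) := ⟨Finsupp.single [] 1, by simp [eval]⟩
    simpa using h x 1 h1
  intro x
  induction x using FreeAlgebra.induction with
  | grade0 c =>
    intro w hw
    rw [AlgHom.commutes, ← Algebra.smul_def]
    exact Submodule.smul_mem _ _ hw
  | grade1 g =>
    rintro _ ⟨c, rfl⟩
    exact ⟨consMap g c, eval_consMap ε g c⟩
  | mul x y hx hy =>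
    intro w hw
    rw [map_mul, mul_assoc]
    exact hx _ (hy w hw)
  | add x y hx hy =>
    intro w hw
    rw [map_add, add_mul]
    exact Submodule.add_mem _ (hx w hw) (hy w hw)

/-- Every element of `W(ε)` has a totally symmetric expression. -/
theorem eval_surjOn_symm (ε : ℝ) (w : W ε) : ∃ c ∈ Symm, eval ε c = w := by
  obtain ⟨c, rfl⟩ := eval_surjective ε w
  change eval ε c ∈ Submodule.map (eval ε) Symm
  induction c using Finsupp.induction_linear with
  | zero => simp
  | add c d hc hd => rw [map_add]; exact Submodule.add_mem _ hc hd
  | single l z =>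
    have h : (l.map (gen ε)).prod ∈ shortWords ε (l.length + 1) :=
      Submodule.subset_span ⟨l, Nat.lt_succ_self _, rfl⟩
    simpa [eval] using Submodule.smul_mem _ z (shortWords_le_eval_symm ε _ h)

/-! ### The Moyal representation and the symbol map -/

/-- The sign in the bracket of a generator with its conjugate: `[g, g†] = sign g · ε`. -/
def Gen.sign : Gen → ℂ
  | .ap => -1
  | .am => 1
  | .bp => -1
  | .bm => 1

/-- Left multiplication by a generator in the Weyl symbol calculus. -/
def moyalL (ε : ℝ) (g : Gen) : Module.End ℂ Poly :=
  LinearMap.mulLeft ℂ (X g) + ((ε : ℂ) / 2 * g.sign) • (pderiv g.conj).toLinearMap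

/-- Right multiplication by a generator in the Weyl symbol calculus. -/
def moyalR (ε : ℝ) (g : Gen) : Module.End ℂ Poly :=
  LinearMap.mulLeft ℂ (X g) - ((ε : ℂ) / 2 * g.sign) • (pderiv g.conj).toLinearMap

theorem moyalL_apply (ε : ℝ) (g : Gen) (f : Poly) :
    moyalL ε g f = X g * f + ((ε : ℂ) / 2 * g.sign) • pderiv g.conj f := rfl

theorem moyalR_apply (ε : ℝ) (g : Gen) (f : Poly) :
    moyalR ε g f = X g * f - ((ε : ℂ) / 2 * g.sign) • pderiv g.conj f := rfl

theorem pderiv_comm (g h : Gen) (f : Poly) : pderiv g (pderiv h f) = pderiv h (pderiv g f) := by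
  ext μ
  simp only [coeff_pderiv, add_assoc]
  by_cases e : g = h
  · subst e; rfl
  · rw [add_comm (Finsupp.single g 1)]
    simp only [Finsupp.add_apply, Finsupp.single_apply, if_neg e, if_neg (Ne.symm e), add_zero]
    ring

theorem moyalL_commutator (ε : ℝ) (g h : Gen) (f : Poly) :
    moyalL ε g (moyalL ε h f) - moyalL ε h (moyalL ε g f) =
      (if h = g.conj then (ε : ℂ) * g.sign else 0) • f := by
  simp only [moyalL_apply, map_add, map_smul, pderiv_X_mul, smul_add]
  rw [pderiv_comm g.conj h.conj, mul_left_comm (X g) (X h)]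
  cases g <;> cases h <;> simp [Gen.conj, Gen.sign] <;> module

theorem moyalL_moyalR_comm (ε : ℝ) (g h : Gen) (f : Poly) :
    moyalL ε g (moyalR ε h f) = moyalR ε h (moyalL ε g f) := by
  rw [← sub_eq_zero]
  simp only [moyalL_apply, moyalR_apply, map_add, map_sub, map_smul, pderiv_X_mul,
    smul_add, smul_sub]
  rw [pderiv_comm g.conj h.conj, mul_left_comm (X g) (X h)]
  cases g <;> cases h <;> simp [Gen.conj, Gen.sign] <;> module

/-- The left Moyal representation of `W(ε)` on symbols. -/
def moyal (ε : ℝ) : W ε →ₐ[ℂ] Module.End ℂ Poly :=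
  lift ε (FreeAlgebra.lift ℂ (moyalL ε)) <| by
    intro x y h
    refine LinearMap.ext fun f => ?_
    rw [← sub_eq_zero]
    cases h <;> simp only [map_sub, map_mul, FreeAlgebra.lift_ι_apply, AlgHom.commutes,
      LinearMap.sub_apply, Module.End.mul_apply, Module.algebraMap_end_apply,
      moyalL_commutator] <;> simp [Gen.conj, Gen.sign]

theorem moyal_gen (ε : ℝ) (g : Gen) : moyal ε (gen ε g) = moyalL ε g := by
  rw [moyal, gen, lift_mk, FreeAlgebra.lift_ι_apply]

/-- The Weyl symbol of an element of `W(ε)`: its action on `1`. -/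
def symbol (ε : ℝ) : W ε →ₗ[ℂ] Poly :=
  (LinearMap.applyₗ (1 : Poly)) ∘ₗ (moyal ε).toLinearMap

theorem symbol_apply (ε : ℝ) (w : W ε) : symbol ε w = moyal ε w 1 := rfl

theorem symbol_one (ε : ℝ) : symbol ε 1 = 1 := by simp [symbol_apply]

theorem symbol_gen_mul (ε : ℝ) (g : Gen) (w : W ε) :
    symbol ε (gen ε g * w) = moyalL ε g (symbol ε w) := by
  rw [symbol_apply, map_mul, moyal_gen]; rfl

/-- Left and right Moyal multiplications commute, as in any associative algebra. -/
theorem moyal_moyalR_comm (ε : ℝ) (w : W ε) (h : Gen) (f : Poly) :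
    moyal ε w (moyalR ε h f) = moyalR ε h (moyal ε w f) := by
  obtain ⟨x, rfl⟩ := mk_surjective ε w
  induction x using FreeAlgebra.induction generalizing f with
  | grade0 c => simp
  | grade1 g =>
    change moyal ε (gen ε g) _ = moyalR ε h (moyal ε (gen ε g) f)
    rw [moyal_gen, moyalL_moyalR_comm]
  | mul v w hv hw => simp [hv, hw]
  | add v w hv hw => simp [hv, hw]

theorem symbol_mul_gen (ε : ℝ) (w : W ε) (g : Gen) :
    symbol ε (w * gen ε g) = moyalR ε g (symbol ε w) := by
  have h : moyalL ε g 1 = moyalR ε g 1 := by simp [moyalL_apply, moyalR_apply]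
  rw [symbol_apply, map_mul, Module.End.mul_apply, moyal_gen, h, moyal_moyalR_comm]
  rfl

/-- The symbol of a symmetric noncommutative polynomial is its commutative image: the derivative
terms of the Moyal product cancel by the antisymmetry of the bracket. -/
theorem symbol_eval (ε : ℝ) {c : WordPoly} (hc : c ∈ Symm) : symbol ε (eval ε c) = abel c := by
  obtain ⟨N, hN⟩ := exists_lenLT c
  induction N generalizing c with
  | zero => simp [eq_zero_of_lenLT_zero hN]
  | succ N ih =>
    have key : ∀ g h, wordDeriv h (tail g c) = wordDeriv g (tail h c) := by
      intro g h
      ext l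
      rw [wordDeriv_apply, wordDeriv_apply, tail_apply, tail_apply,
        hc (h :: g :: l) (g :: h :: l) (List.Perm.swap _ _ _)]
    rw [eval_eq_sum, abel_eq_sum, map_add, map_sum]
    congr 1
    · rw [Algebra.algebraMap_eq_smul_one, map_smul, symbol_one, smul_eq_C_mul, mul_one]
    · simp only [symbol_gen_mul, ih (tail_mem_symm hc _) (hN.tail _), moyalL_apply,
        pderiv_abel (tail_mem_symm hc _), Finset.sum_add_distrib]
      rw [add_eq_left, sum_gen]
      simp only [Gen.conj, Gen.sign]
      rw [key .am .ap, key .bm .bp]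
      module

theorem symbol_injective (ε : ℝ) : Function.Injective (symbol ε) := by
  rw [← LinearMap.ker_eq_bot, LinearMap.ker_eq_bot']
  intro w hw
  obtain ⟨c, hc, rfl⟩ := eval_surjOn_symm ε w
  rw [symbol_eval ε hc] at hw
  rw [abel_injOn_symm hc hw, map_zero]

theorem symbol_surjective (ε : ℝ) : Function.Surjective (symbol ε) := fun f => by
  obtain ⟨c, hc, rfl⟩ := abel_surjOn_symm f
  exact ⟨eval ε c, symbol_eval ε hc⟩

theorem pi0_eq (ε : ℝ) (w : W ε) : pi0 ε w = constantCoeff (symbol ε w) := by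
  have h : ∃ c ∈ (Symm : Set WordPoly), eval ε c = w := eval_surjOn_symm ε w
  have h1 : symmExpr ε w ∈ Symm := Function.invFunOn_mem h
  have h2 : eval ε (symmExpr ε w) = w := Function.invFunOn_eq h
  rw [pi0, ← coeff_zero_abel, ← symbol_eval ε h1, h2]

/-! ### Traceless elements and harmonic symbols -/

/-- The Laplace operator dual to the quadratic form `a₊a₋ + b₊b₋`. -/
def lap : Poly →ₗ[ℂ] Poly :=
  (pderiv .ap).toLinearMap ∘ₗ (pderiv .am).toLinearMap
    + (pderiv .bp).toLinearMap ∘ₗ (pderiv .bm).toLinearMap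

theorem lap_apply (f : Poly) :
    lap f = pderiv .ap (pderiv .am f) + pderiv .bp (pderiv .bm f) := rfl

theorem formalTrace_apply {c : WordPoly} (hc : c ∈ Symm) (l : List Gen) :
    formalTrace c l = 2 * (c (.am :: .ap :: l) + c (.bm :: .bp :: l)) := by
  have h : ∀ x y, c (l ++ [x, y]) = c (x :: y :: l) := fun x y =>
    hc _ _ (List.perm_append_comm (l₁ := l) (l₂ := [x, y]))
  have h' : ∀ x y, c (x :: y :: l) = c (y :: x :: l) := fun x y =>
    hc _ _ (List.Perm.swap _ _ _)
  simp only [formalTrace, LinearMap.add_apply, Finsupp.add_apply, cofactor_apply, h]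
  rw [h' .ap .am, h' .bp .bm]
  ring

theorem lap_abel_eq_zero_iff {c : WordPoly} (hc : c ∈ Symm) :
    lap (abel c) = 0 ↔ formalTrace c = 0 := by
  have hs : ∀ g h, wordDeriv g (wordDeriv h c) ∈ Symm := fun g h =>
    wordDeriv_mem_symm (wordDeriv_mem_symm hc h) g
  rw [lap_apply, pderiv_abel hc, pderiv_abel hc, pderiv_abel (wordDeriv_mem_symm hc _),
    pderiv_abel (wordDeriv_mem_symm hc _), ← map_add]
  have e : ∀ l, (wordDeriv .ap (wordDeriv .am c) + wordDeriv .bp (wordDeriv .bm c)) l =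
      (((l.length : ℂ) + 1) * ((l.length + 1 : ℕ) + 1) / 2) * formalTrace c l := by
    intro l
    rw [Finsupp.add_apply, formalTrace_apply hc]
    simp only [wordDeriv_apply, List.length_cons]
    push_cast
    ring
  constructor
  · intro h
    have h0 := abel_injOn_symm (Symm.add_mem (hs _ _) (hs _ _)) h
    ext l
    have h1 := e l
    rw [h0] at h1
    refine (mul_eq_zero.1 h1.symm).resolve_left (div_ne_zero (mul_ne_zero ?_ ?_) two_ne_zero) <;>
      exact Nat.cast_add_one_ne_zero _
  · intro h
    have : wordDeriv .ap (wordDeriv .am c) + wordDeriv .bp (wordDeriv .bm c) = 0 :=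
      Finsupp.ext fun l => by rw [e l, h]; simp
    rw [this, map_zero]

/-- An element of `W(ε)` has zero formal trace if and only if its symbol is harmonic. -/
theorem mem_Psi_iff (ε : ℝ) (w : W ε) : w ∈ Psi ε ↔ lap (symbol ε w) = 0 := by
  constructor
  · rintro ⟨c, ⟨hc, ht⟩, rfl⟩
    rw [symbol_eval ε hc]
    exact (lap_abel_eq_zero_iff hc).2 ht
  · intro h
    obtain ⟨c, hc, rfl⟩ := eval_surjOn_symm ε w
    rw [symbol_eval ε hc] at h
    exact ⟨c, ⟨hc, (lap_abel_eq_zero_iff hc).1 h⟩, rfl⟩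

/-! ### Harmonic decomposition of homogeneous polynomials -/

/-- Multiplication by the quadratic form `a₊a₋ + b₊b₋`. -/
def quad : Poly →ₗ[ℂ] Poly := LinearMap.mulLeft ℂ (X .ap * X .am + X .bp * X .bm)

theorem quad_apply (f : Poly) :
    quad f = X .ap * (X .am * f) + X .bp * (X .bm * f) := by
  rw [quad, LinearMap.mulLeft_apply]; ring

theorem lap_quad (f : Poly) : lap (quad f) = quad (lap f) + ∑ g, X g * pderiv g f + 2 * f := by
  simp only [lap_apply, quad_apply, sum_gen, map_add, pderiv_X_mul, reduceCtorEq, if_false,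
    if_true, add_zero]
  ring

theorem isHomogeneous_lap {N : ℕ} {f : Poly} (h : f.IsHomogeneous (N + 2)) :
    (lap f).IsHomogeneous N :=
  (h.pderiv.pderiv).add (h.pderiv.pderiv)

theorem lap_eq_zero_of_lt_two {N : ℕ} (hN : N < 2) {f : Poly} (h : f.IsHomogeneous N) :
    lap f = 0 := by
  have h1 : ∀ g, (pderiv g f).IsHomogeneous 0 := fun g => by
    have := h.pderiv (i := g)
    rwa [show N - 1 = 0 by omega] at this
  have h2 : ∀ g g', pderiv g' (pderiv g f) = 0 := fun g g' => by
    rw [totalDegree_eq_zero_iff_eq_C.1 ((totalDegree_zero_iff_isHomogeneous _).2 (h1 g)), pderiv_C]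
  rw [lap_apply, h2, h2, add_zero]

theorem isHomogeneous_quad {N : ℕ} {f : Poly} (h : f.IsHomogeneous N) :
    (quad f).IsHomogeneous (N + 2) := by
  rw [quad, LinearMap.mulLeft_apply, add_comm N]
  exact (((isHomogeneous_X _ _).mul (isHomogeneous_X _ _)).add
    ((isHomogeneous_X _ _).mul (isHomogeneous_X _ _))).mul h

/-- On homogeneous polynomials the commutator of `lap` and `quad` is a positive constant, by
Euler's identity. -/
theorem lap_quad_of_isHomogeneous {N : ℕ} {f : Poly} (h : f.IsHomogeneous N) :
    lap (quad f) = quad (lap f) + ((N + 2 : ℕ) : ℂ) • f := by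
  rw [lap_quad, h.sum_X_mul_pderiv, Nat.cast_smul_eq_nsmul, add_smul, add_assoc, two_mul, two_nsmul]

/-- Applying the Laplace operator turns the equation for `f` into one of the same kind for
`lap f`, with two degrees less and a larger constant. -/
theorem eq_zero_of_quad_lap_add {N : ℕ} {c : ℕ} (hc : 0 < c) {f : Poly} (h : f.IsHomogeneous N)
    (h0 : quad (lap f) + (c : ℂ) • f = 0) : f = 0 := by
  have hc' : (c : ℂ) ≠ 0 := Nat.cast_ne_zero.2 hc.ne'
  suffices hl : lap f = 0 by
    rw [hl, map_zero, zero_add] at h0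
    exact (smul_eq_zero.1 h0).resolve_left hc'
  induction N using Nat.strong_induction_on generalizing c f with
  | _ N ih =>
    rcases lt_or_ge N 2 with hN | hN
    · exact lap_eq_zero_of_lt_two hN h
    · obtain ⟨M, rfl⟩ := Nat.exists_eq_add_of_le' hN
      have hM := isHomogeneous_lap h
      have h1 := congrArg lap h0
      rw [map_add, map_smul, map_zero, lap_quad_of_isHomogeneous hM, add_assoc, ← add_smul,
        ← Nat.cast_add] at h1
      have hpos : 0 < M + 2 + c := by omega
      have h2 := ih M (by omega) hpos hM h1 (Nat.cast_ne_zero.2 hpos.ne')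
      rw [h2, map_zero, zero_add] at h1
      exact (smul_eq_zero.1 h1).resolve_left (Nat.cast_ne_zero.2 hpos.ne')

/-- The operator `quad ∘ lap + c` is onto in each degree, by the same descent as in
`eq_zero_of_quad_lap_add`. -/
theorem exists_quad_lap_add {N : ℕ} {c : ℕ} (hc : 0 < c) {h : Poly} (hh : h.IsHomogeneous N) :
    ∃ f : Poly, f.IsHomogeneous N ∧ quad (lap f) + (c : ℂ) • f = h := by
  induction N using Nat.strong_induction_on generalizing c h with
  | _ N ih =>
    have hc' : (c : ℂ) ≠ 0 := Nat.cast_ne_zero.2 hc.ne'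
    rcases lt_or_ge N 2 with hN | hN
    · refine ⟨(c : ℂ)⁻¹ • h, (homogeneousSubmodule _ _ _).smul_mem _ hh, ?_⟩
      rw [map_smul, lap_eq_zero_of_lt_two hN hh, smul_zero, map_zero, zero_add, smul_smul,
        mul_inv_cancel₀ hc', one_smul]
    · obtain ⟨M, rfl⟩ := Nat.exists_eq_add_of_le' hN
      obtain ⟨u, hu, e⟩ := ih M (by omega) (c := M + 2 + c) (by omega) (isHomogeneous_lap hh)
      -- `u` solves the equation that `lap f` has to satisfy
      refine ⟨(c : ℂ)⁻¹ • (h - quad u), (homogeneousSubmodule _ _ _).smul_mem _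
        (hh.sub (isHomogeneous_quad hu)), ?_⟩
      have h1 : lap ((c : ℂ)⁻¹ • (h - quad u)) = u := by
        rw [map_smul, map_sub, lap_quad_of_isHomogeneous hu, ← e, Nat.cast_add _ c, add_smul,
          add_sub_add_left_eq_sub, add_sub_cancel_left, smul_smul, inv_mul_cancel₀ hc', one_smul]
      rw [h1, smul_smul, mul_inv_cancel₀ hc', one_smul, add_sub_cancel]

/-! ### The degree filtration -/

/-- The polynomials of degree less than `N`. -/
def degLT (N : ℕ) : Submodule ℂ Poly where
  carrier := {f | ∀ μ : Gen →₀ ℕ, N ≤ μ.degree → coeff μ f = 0}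
  add_mem' hf hg μ h := by rw [coeff_add, hf μ h, hg μ h, add_zero]
  zero_mem' _ _ := coeff_zero _
  smul_mem' c f hf μ h := by rw [coeff_smul, hf μ h, smul_zero]

theorem degLT_mono {M N : ℕ} (h : M ≤ N) : degLT M ≤ degLT N :=
  fun _ hf μ hμ => hf μ (h.trans hμ)

theorem eq_zero_of_mem_degLT_zero {f : Poly} (h : f ∈ degLT 0) : f = 0 := by
  ext μ
  exact h μ (Nat.zero_le _)

theorem exists_mem_degLT (f : Poly) : ∃ N, f ∈ degLT N := by
  refine ⟨f.support.sup Finsupp.degree + 1, fun μ hμ => ?_⟩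
  by_contra h
  have := Finset.le_sup (f := Finsupp.degree) (mem_support_iff.2 h)
  omega

theorem X_mul_mem_degLT {N : ℕ} {f : Poly} (h : f ∈ degLT N) (g : Gen) :
    X g * f ∈ degLT (N + 1) := fun μ hμ => by
  rw [coeff_X_mul']
  split_ifs with hg
  · refine h _ ?_
    have h1 : Finsupp.single g 1 ≤ μ := by
      rw [Finsupp.single_le_iff]
      exact Nat.one_le_iff_ne_zero.2 (Finsupp.mem_support_iff.1 hg)
    have h2 := congrArg Finsupp.degree (tsub_add_cancel_of_le h1)
    rw [map_add, Finsupp.degree_single] at h2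
    omega
  · rfl

theorem pderiv_mem_degLT {N : ℕ} {f : Poly} (h : f ∈ degLT (N + 1)) (g : Gen) :
    pderiv g f ∈ degLT N := fun μ hμ => by
  rw [coeff_pderiv, h _ (by rw [map_add, Finsupp.degree_single]; omega), zero_mul]

theorem X_mul_pderiv_mem_degLT {N : ℕ} {f : Poly} (h : f ∈ degLT N) (g : Gen) :
    X g * pderiv g f ∈ degLT N := by
  cases N with
  | zero => simp [eq_zero_of_mem_degLT_zero h]
  | succ N => exact X_mul_mem_degLT (pderiv_mem_degLT h g) g

theorem lap_mem_degLT {N : ℕ} {f : Poly} (h : f ∈ degLT (N + 2)) : lap f ∈ degLT N :=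
  Submodule.add_mem _ (pderiv_mem_degLT (pderiv_mem_degLT h _) _)
    (pderiv_mem_degLT (pderiv_mem_degLT h _) _)

theorem quad_mem_degLT {N : ℕ} {f : Poly} (h : f ∈ degLT N) : quad f ∈ degLT (N + 2) := by
  rw [quad_apply]
  exact Submodule.add_mem _ (X_mul_mem_degLT (X_mul_mem_degLT h _) _)
    (X_mul_mem_degLT (X_mul_mem_degLT h _) _)

theorem homogeneousComponent_of_mem_degLT {N : ℕ} {f : Poly} (h : f ∈ degLT N) :
    homogeneousComponent N f = 0 := by
  ext μ
  rw [coeff_homogeneousComponent, coeff_zero]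
  split_ifs with e
  · exact h μ e.ge
  · rfl

theorem sub_homogeneousComponent_mem_degLT {N : ℕ} {f : Poly} (h : f ∈ degLT (N + 1)) :
    f - homogeneousComponent N f ∈ degLT N := fun μ hμ => by
  rw [coeff_sub, coeff_homogeneousComponent]
  split_ifs with e
  · exact sub_self _
  · rw [h μ (by omega), sub_zero]

theorem mem_degLT_of_isHomogeneous {N : ℕ} {f : Poly} (h : f.IsHomogeneous N) :
    f ∈ degLT (N + 1) := fun _ hμ => h.coeff_eq_zero (by omega)

/-! ### The projection onto the traceless elements -/

/-- The part of right multiplication by `K₀ - R̂` on symbols that does not raise the degree. -/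
def lowerPart (ε R : ℝ) (f : Poly) : Poly :=
  ((ε : ℂ) / 4) • (X .am * pderiv .am f - X .ap * pderiv .ap f
    + (X .bm * pderiv .bm f - X .bp * pderiv .bp f))
  - ((ε : ℂ) ^ 2 / 8) • lap f - (Rhat ε R : ℂ) • f

theorem lowerPart_mem_degLT (ε R : ℝ) {N : ℕ} {f : Poly} (h : f ∈ degLT N) :
    lowerPart ε R f ∈ degLT N := by
  refine Submodule.sub_mem _ (Submodule.sub_mem _ (Submodule.smul_mem _ _ ?_)
    (Submodule.smul_mem _ _ (lap_mem_degLT (degLT_mono (Nat.le_add_right _ _) h))))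
    (Submodule.smul_mem _ _ h)
  exact Submodule.add_mem _
    (Submodule.sub_mem _ (X_mul_pderiv_mem_degLT h _) (X_mul_pderiv_mem_degLT h _))
    (Submodule.sub_mem _ (X_mul_pderiv_mem_degLT h _) (X_mul_pderiv_mem_degLT h _))

/-- Right multiplication by `K₀ - R̂` on symbols. -/
def rightK (ε R : ℝ) (f : Poly) : Poly := (1 / 2 : ℂ) • quad f + lowerPart ε R f

/-- The summand `ε` of `2 K₀` cancels the constants that come from ordering `a₊a₋` and `b₊b₋`. -/
theorem symbol_mul_K0_sub (ε R : ℝ) (w : W ε) :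
    symbol ε (w * (K0 ε - algebraMap ℂ (W ε) (Rhat ε R : ℂ))) = rightK ε R (symbol ε w) := by
  have e : w * (K0 ε - algebraMap ℂ (W ε) (Rhat ε R : ℂ)) =
      (1 / 2 : ℂ) • (w * ap ε * am ε + w * bp ε * bm ε + (ε : ℂ) • w) - (Rhat ε R : ℂ) • w := by
    rw [K0, mul_sub, mul_smul_comm, mul_add, mul_add, ← mul_assoc, ← mul_assoc,
      ← Algebra.commutes, ← Algebra.smul_def, ← Algebra.commutes, ← Algebra.smul_def]
  rw [e]
  simp only [map_sub, map_smul, map_add, symbol_mul_gen, rightK, lowerPart, quad_apply,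
    moyalR_apply, lap_apply, pderiv_X_mul, Gen.conj, Gen.sign, if_true]
  rw [mul_left_comm (X Gen.am : Poly) (X Gen.ap), mul_left_comm (X Gen.bm : Poly) (X Gen.bp)]
  module

theorem rightK_sub (ε R : ℝ) (f g : Poly) :
    rightK ε R (f - g) = rightK ε R f - rightK ε R g := by
  simp only [rightK, lowerPart, map_sub, mul_sub]
  module

/-- The leading part of `lap ∘ rightK` is `½ lap ∘ quad`. -/
theorem lap_rightK_sub_mem (ε R : ℝ) {N : ℕ} {f f₀ : Poly} (h : f ∈ degLT (N + 1))
    (h₀ : f - f₀ ∈ degLT N) : lap (rightK ε R f) - (1 / 2 : ℂ) • lap (quad f₀) ∈ degLT N := by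
  have e : lap (rightK ε R f) - (1 / 2 : ℂ) • lap (quad f₀) =
      (1 / 2 : ℂ) • lap (quad (f - f₀)) + lap (lowerPart ε R f) := by
    simp only [rightK, map_add, map_smul, map_sub]
    module
  rw [e]
  exact Submodule.add_mem _ (Submodule.smul_mem _ _ (lap_mem_degLT (quad_mem_degLT h₀)))
    (lap_mem_degLT (degLT_mono (Nat.le_succ _) (lowerPart_mem_degLT ε R h)))

theorem eq_zero_of_lap_rightK (ε R : ℝ) {f : Poly} (h0 : lap (rightK ε R f) = 0) : f = 0 := by
  obtain ⟨N, hN⟩ := exists_mem_degLT f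
  induction N with
  | zero => exact eq_zero_of_mem_degLT_zero hN
  | succ N ih =>
    refine ih ?_
    have hf := homogeneousComponent_isHomogeneous N f
    have h1 := lap_rightK_sub_mem ε R hN (sub_homogeneousComponent_mem_degLT hN)
    rw [h0, zero_sub] at h1
    have h2 := homogeneousComponent_of_mem_degLT h1
    rw [lap_quad_of_isHomogeneous hf] at h2
    have h3 : (quad (lap (homogeneousComponent N f)) +
        ((N + 2 : ℕ) : ℂ) • homogeneousComponent N f).IsHomogeneous N := by
      rw [← lap_quad_of_isHomogeneous hf]
      exact isHomogeneous_lap (isHomogeneous_quad hf)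
    rw [map_neg, map_smul, homogeneousComponent_eq_self h3, neg_eq_zero, smul_eq_zero] at h2
    have h4 := sub_homogeneousComponent_mem_degLT hN
    rwa [eq_zero_of_quad_lap_add (Nat.succ_pos _) hf (h2.resolve_left (by norm_num)),
      sub_zero] at h4

theorem exists_lap_rightK_eq (ε R : ℝ) (h : Poly) : ∃ f, lap (rightK ε R f) = h := by
  obtain ⟨N, hN⟩ := exists_mem_degLT h
  induction N generalizing h with
  | zero => exact ⟨0, by simp [eq_zero_of_mem_degLT_zero hN, rightK, lowerPart]⟩
  | succ N ih =>
    have hh : ((2 : ℂ) • homogeneousComponent N h).IsHomogeneous N :=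
      (homogeneousSubmodule _ _ _).smul_mem _ (homogeneousComponent_isHomogeneous N h)
    obtain ⟨f, hf, e⟩ := exists_quad_lap_add (c := N + 2) (Nat.succ_pos _) hh
    have h1 := lap_rightK_sub_mem ε R (f₀ := f) (mem_degLT_of_isHomogeneous hf) (by simp)
    rw [lap_quad_of_isHomogeneous hf, e, smul_smul, one_div, inv_mul_cancel₀ two_ne_zero,
      one_smul] at h1
    have h2 := Submodule.sub_mem _ (sub_homogeneousComponent_mem_degLT hN) h1
    rw [sub_sub_sub_cancel_right] at h2
    obtain ⟨f', e'⟩ := ih _ h2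
    refine ⟨f' - -f, ?_⟩
    have h3 : rightK ε R (-f) = - rightK ε R f := by
      simpa [rightK, lowerPart] using rightK_sub ε R 0 f
    rw [rightK_sub, map_sub, e', h3, map_neg]
    abel

/-- Since `lap` composed with right multiplication by `K₀ - R̂` is bijective on symbols, the
kernel of `lap` and the range of that multiplication are complementary. -/
theorem isCompl_Psi_kerRho (ε R : ℝ) : IsCompl (Psi ε) (kerRho ε R) := by
  constructor
  · rw [Submodule.disjoint_def]
    rintro _ hw ⟨v, rfl⟩
    rw [mem_Psi_iff, LinearMap.mulRight_apply, symbol_mul_K0_sub] at hw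
    have hv : v = 0 := symbol_injective ε (by rw [eq_zero_of_lap_rightK ε R hw, map_zero])
    rw [hv, map_zero]
  · rw [codisjoint_iff, eq_top_iff]
    rintro w -
    obtain ⟨f, hf⟩ := exists_lap_rightK_eq ε R (lap (symbol ε w))
    obtain ⟨v, rfl⟩ := symbol_surjective ε f
    have hp : w - v * (K0 ε - algebraMap ℂ (W ε) (Rhat ε R : ℂ)) ∈ Psi ε := by
      rw [mem_Psi_iff, map_sub, map_sub, symbol_mul_K0_sub, hf, sub_self]
    have hk : v * (K0 ε - algebraMap ℂ (W ε) (Rhat ε R : ℂ)) ∈ kerRho ε R := ⟨v, rfl⟩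
    simpa using Submodule.add_mem_sup hp hk

/-- The functional `π₀ ∘ ρ`. -/
def phi (ε R : ℝ) : W ε →ₗ[ℂ] ℂ := lcoeff ℂ 0 ∘ₗ symbol ε ∘ₗ rho ε R

theorem pi0_rho_eq (ε R : ℝ) (w : W ε) : pi0 ε (rho ε R w) = phi ε R w := pi0_eq ε _

theorem rho_of_mem_Psi {ε : ℝ} (R : ℝ) {w : W ε} (h : w ∈ Psi ε) : rho ε R w = w := by
  rw [rho, dif_pos (isCompl_Psi_kerRho ε R), LinearMap.comp_apply,
    Submodule.projectionOnto_apply_of_mem_left _ h]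
  rfl

theorem rho_of_mem_kerRho {ε R : ℝ} {w : W ε} (h : w ∈ kerRho ε R) : rho ε R w = 0 := by
  rw [rho, dif_pos (isCompl_Psi_kerRho ε R), LinearMap.comp_apply,
    (Submodule.projectionOnto_apply_eq_zero_iff _).2 h, map_zero]

theorem phi_one (ε R : ℝ) : phi ε R 1 = 1 := by
  have h : (1 : W ε) ∈ Psi ε := by
    rw [mem_Psi_iff, symbol_one, lap_apply]
    simp
  rw [← pi0_rho_eq, rho_of_mem_Psi R h, pi0_eq, symbol_one, map_one]

theorem phi_mul_K0_sub (ε R : ℝ) (w : W ε) :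
    phi ε R (w * (K0 ε - algebraMap ℂ (W ε) (Rhat ε R : ℂ))) = 0 := by
  have h : w * (K0 ε - algebraMap ℂ (W ε) (Rhat ε R : ℂ)) ∈ kerRho ε R := ⟨w, rfl⟩
  rw [phi, LinearMap.comp_apply, LinearMap.comp_apply, rho_of_mem_kerRho h, map_zero, map_zero]

/-! ### The raising derivation -/

theorem dagger_dagger (ε : ℝ) (w : W ε) : dagger ε (dagger ε w) = w := by
  obtain ⟨x, rfl⟩ := mk_surjective ε w
  induction x using FreeAlgebra.induction with
  | grade0 c => rw [AlgHom.commutes, dagger_algebraMap, dagger_algebraMap, Complex.conj_conj]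
  | grade1 g =>
    change dagger ε (dagger ε (gen ε g)) = gen ε g
    rw [dagger_gen, dagger_gen]
    cases g <;> rfl
  | mul v w hv hw => rw [map_mul, dagger_mul, dagger_mul, hv, hw]
  | add v w hv hw => rw [map_add, dagger_add, dagger_add, hv, hw]

theorem dagger_smul (ε : ℝ) (z : ℂ) (w : W ε) :
    dagger ε (z • w) = starRingEnd ℂ z • dagger ε w := by
  rw [Algebra.smul_def, dagger_mul, dagger_algebraMap, ← Algebra.commutes, ← Algebra.smul_def]

theorem dagger_pow (ε : ℝ) (w : W ε) (k : ℕ) : dagger ε (w ^ k) = dagger ε w ^ k := by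
  induction k with
  | zero => simpa using dagger_algebraMap ε 1
  | succ k ih => rw [pow_succ, dagger_mul, ih, pow_succ']

/-- The derivation `w ↦ -(D w†)†`, which is `a₊ ∂/∂b₊ - b₋ ∂/∂a₋` and satisfies
`ε · raise = Ad_{J₊}` for `J₊ = a₊ b₋`. -/
def raise (ε : ℝ) : W ε →ₗ[ℂ] W ε where
  toFun w := -dagger ε (der ε (dagger ε w))
  map_add' v w := by rw [dagger_add, map_add, dagger_add, neg_add]
  map_smul' z w := by
    rw [dagger_smul, map_smul, dagger_smul, Complex.conj_conj, smul_neg, RingHom.id_apply]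

theorem raise_apply (ε : ℝ) (w : W ε) : raise ε w = -dagger ε (der ε (dagger ε w)) := rfl

theorem dagger_der (ε : ℝ) (w : W ε) : dagger ε (der ε w) = -raise ε (dagger ε w) := by
  rw [raise_apply, dagger_dagger, neg_neg]

/-- The Leibniz rule. -/
def IsLeibniz {ε : ℝ} (δ : W ε →ₗ[ℂ] W ε) : Prop := ∀ v w, δ (v * w) = v * δ w + δ v * w

theorem isLeibniz_der (ε : ℝ) : IsLeibniz (der ε) := der_mul ε

theorem isLeibniz_raise (ε : ℝ) : IsLeibniz (raise ε) := fun v w => by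
  simp only [raise_apply, dagger_mul, der_mul, dagger_add, dagger_dagger]
  noncomm_ring

theorem IsLeibniz.commutator {ε : ℝ} {δ₁ δ₂ : W ε →ₗ[ℂ] W ε} (h₁ : IsLeibniz δ₁)
    (h₂ : IsLeibniz δ₂) : IsLeibniz (δ₁ ∘ₗ δ₂ - δ₂ ∘ₗ δ₁) := fun v w => by
  simp only [LinearMap.sub_apply, LinearMap.comp_apply, h₂ v w, h₁ v w, map_add, h₁ v, h₁ _ w,
    h₂ v, h₂ _ w]
  noncomm_ring

theorem IsLeibniz.map_one {ε : ℝ} {δ : W ε →ₗ[ℂ] W ε} (h : IsLeibniz δ) : δ 1 = 0 := by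
  have := h 1 1
  simpa using this

theorem IsLeibniz.map_algebraMap {ε : ℝ} {δ : W ε →ₗ[ℂ] W ε} (h : IsLeibniz δ) (z : ℂ) :
    δ (algebraMap ℂ (W ε) z) = 0 := by
  rw [Algebra.algebraMap_eq_smul_one, map_smul, h.map_one, smul_zero]

theorem IsLeibniz.ext {ε : ℝ} {δ₁ δ₂ : W ε →ₗ[ℂ] W ε} (h₁ : IsLeibniz δ₁) (h₂ : IsLeibniz δ₂)
    (h : ∀ g, δ₁ (gen ε g) = δ₂ (gen ε g)) (w : W ε) : δ₁ w = δ₂ w := by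
  obtain ⟨x, rfl⟩ := mk_surjective ε w
  induction x using FreeAlgebra.induction with
  | grade0 c => rw [AlgHom.commutes, h₁.map_algebraMap, h₂.map_algebraMap]
  | grade1 g => exact h g
  | mul v w hv hw => rw [map_mul, h₁, h₂, hv, hw]
  | add v w hv hw => rw [_root_.map_add, _root_.map_add, _root_.map_add, hv, hw]

theorem IsLeibniz.map_pow_eq_zero {ε : ℝ} {δ : W ε →ₗ[ℂ] W ε} (h : IsLeibniz δ) {w : W ε}
    (hw : δ w = 0) (k : ℕ) : δ (w ^ k) = 0 := by
  induction k with
  | zero => rw [pow_zero, h.map_one]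
  | succ k ih => rw [pow_succ, h, ih, hw, mul_zero, zero_mul, add_zero]

theorem IsLeibniz.map_pow_succ {ε : ℝ} {δ : W ε →ₗ[ℂ] W ε} (h : IsLeibniz δ) {w : W ε}
    (hw : Commute w (δ w)) (k : ℕ) : δ (w ^ (k + 1)) = ((k : ℂ) + 1) • (w ^ k * δ w) := by
  induction k with
  | zero => simp
  | succ k ih =>
    rw [pow_succ, h, ih, smul_mul_assoc, mul_assoc (w ^ k), ← hw.eq, ← mul_assoc, ← pow_succ]
    push_cast
    module

theorem der_ap (ε : ℝ) : der ε (ap ε) = bp ε := der_gen ε .ap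
theorem der_am (ε : ℝ) : der ε (am ε) = 0 := der_gen ε .am
theorem der_bp (ε : ℝ) : der ε (bp ε) = 0 := der_gen ε .bp
theorem der_bm (ε : ℝ) : der ε (bm ε) = -am ε := der_gen ε .bm

theorem dagger_zero (ε : ℝ) : dagger ε 0 = 0 := by simpa using dagger_algebraMap ε 0

theorem raise_ap (ε : ℝ) : raise ε (ap ε) = 0 := by
  rw [raise_apply, dagger_gen]
  change -dagger ε (der ε (am ε)) = 0
  rw [der_am, dagger_zero, neg_zero]

theorem raise_am (ε : ℝ) : raise ε (am ε) = -bm ε := by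
  rw [raise_apply, dagger_gen]
  change -dagger ε (der ε (ap ε)) = _
  rw [der_ap, dagger_gen]
  rfl

theorem raise_bp (ε : ℝ) : raise ε (bp ε) = ap ε := by
  rw [raise_apply, dagger_gen]
  change -dagger ε (der ε (bm ε)) = _
  have h := dagger_smul ε (-1) (am ε)
  rw [neg_one_smul, dagger_gen] at h
  rw [der_bm, h]
  simp
  rfl

theorem raise_bm (ε : ℝ) : raise ε (bm ε) = 0 := by
  rw [raise_apply, dagger_gen]
  change -dagger ε (der ε (bp ε)) = 0
  rw [der_bp, dagger_zero, neg_zero]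

/-- The action of `raise` on symbols. -/
def symRaise : Poly →ₗ[ℂ] Poly :=
  LinearMap.mulLeft ℂ (X .ap) ∘ₗ (pderiv .bp).toLinearMap
    - LinearMap.mulLeft ℂ (X .bm) ∘ₗ (pderiv .am).toLinearMap

theorem symRaise_apply (f : Poly) :
    symRaise f = X .ap * pderiv .bp f - X .bm * pderiv .am f := rfl

/-- The raising derivation is the commutator with `symRaise` in the Moyal representation. -/
theorem moyal_raise (ε : ℝ) (w : W ε) (f : Poly) :
    moyal ε (raise ε w) f = symRaise (moyal ε w f) - moyal ε w (symRaise f) := by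
  obtain ⟨x, rfl⟩ := mk_surjective ε w
  induction x using FreeAlgebra.induction generalizing f with
  | grade0 c => rw [AlgHom.commutes, (isLeibniz_raise ε).map_algebraMap]; simp
  | grade1 g =>
    change moyal ε (raise ε (gen ε g)) f =
      symRaise (moyal ε (gen ε g) f) - moyal ε (gen ε g) (symRaise f)
    cases g
    · rw [raise_ap, moyal_gen]
      simp [moyalL_apply, symRaise_apply, Gen.conj, Gen.sign, pderiv_comm]
      simp only [smul_eq_C_mul]
      ring
    · rw [raise_am, map_neg, moyal_gen, moyal_gen]
      simp [moyalL_apply, symRaise_apply, Gen.conj, Gen.sign, pderiv_comm]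
      simp only [smul_eq_C_mul]
      ring
    · rw [raise_bp, moyal_gen, moyal_gen]
      simp [moyalL_apply, symRaise_apply, Gen.conj, Gen.sign, pderiv_comm]
      simp only [smul_eq_C_mul]
      ring
    · rw [raise_bm, moyal_gen]
      simp [moyalL_apply, symRaise_apply, Gen.conj, Gen.sign, pderiv_comm]
      simp only [smul_eq_C_mul]
      ring
  | mul v w hv hw =>
    rw [map_mul, isLeibniz_raise]
    simp only [map_add, map_mul, LinearMap.add_apply, Module.End.mul_apply, hv, hw, map_sub]
    abel
  | add v w hv hw =>
    simp only [map_add, LinearMap.add_apply, hv, hw]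
    abel

theorem symbol_raise (ε : ℝ) (w : W ε) : symbol ε (raise ε w) = symRaise (symbol ε w) := by
  have h : symRaise 1 = 0 := by simp [symRaise_apply]
  rw [symbol_apply, moyal_raise, h, map_zero, sub_zero, symbol_apply]

theorem lap_symRaise (f : Poly) : lap (symRaise f) = symRaise (lap f) := by
  simp only [lap_apply, symRaise_apply, map_sub, map_add, pderiv_X_mul, reduceCtorEq, if_false,
    if_true, add_zero]
  simp only [pderiv_comm]
  ring

theorem raise_K0 (ε : ℝ) : raise ε (K0 ε) = 0 := by
  rw [K0, map_smul, map_add, map_add, (isLeibniz_raise ε).map_algebraMap,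
    isLeibniz_raise, isLeibniz_raise, raise_ap, raise_am, raise_bp, raise_bm]
  simp

/-- The functional `π₀ ∘ ρ` is invariant: the raising derivation preserves both the traceless
elements and the kernel of `ρ`, and its values have no constant term. -/
theorem phi_raise (ε R : ℝ) (w : W ε) : phi ε R (raise ε w) = 0 := by
  have hw : w ∈ Psi ε ⊔ kerRho ε R := (isCompl_Psi_kerRho ε R).sup_eq_top ▸ Submodule.mem_top
  obtain ⟨p, hp, _, ⟨v, rfl⟩, rfl⟩ := Submodule.mem_sup.1 hw
  have h1 : raise ε p ∈ Psi ε := by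
    rw [mem_Psi_iff] at hp ⊢
    rw [symbol_raise, lap_symRaise, hp, map_zero]
  have h2 : phi ε R (raise ε p) = 0 := by
    rw [← pi0_rho_eq, rho_of_mem_Psi R h1, pi0_eq, symbol_raise, symRaise_apply]
    simp
  rw [map_add, map_add, h2, zero_add, LinearMap.mulRight_apply, isLeibniz_raise, map_sub,
    raise_K0, (isLeibniz_raise ε).map_algebraMap, sub_zero, mul_zero, zero_add, phi_mul_K0_sub]

/-! ### Values of the invariant functional -/

/-- The element `a₋^p a₊^p b₊^q b₋^q`. -/
def diagElt (ε : ℝ) (p q : ℕ) : W ε := am ε ^ p * ap ε ^ p * bp ε ^ q * bm ε ^ q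

theorem am_mul_ap_pow (ε : ℝ) (p : ℕ) :
    am ε * ap ε ^ (p + 1) = ap ε ^ (p + 1) * am ε + (((p : ℂ) + 1) * ε) • ap ε ^ p := by
  have h : am ε * ap ε = ap ε * am ε + (ε : ℂ) • 1 := by
    rw [← Algebra.algebraMap_eq_smul_one, ← am_ap, add_sub_cancel]
  induction p with
  | zero => simpa using h
  | succ p ih =>
    rw [pow_succ, ← mul_assoc, ih, add_mul, mul_assoc, h, mul_add, smul_mul_assoc, ← pow_succ,
      mul_smul_comm, mul_one, ← mul_assoc]
    push_cast
    module

theorem bm_mul_bp_pow (ε : ℝ) (q : ℕ) :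
    bm ε * bp ε ^ (q + 1) = bp ε ^ (q + 1) * bm ε + (((q : ℂ) + 1) * ε) • bp ε ^ q := by
  have h : bm ε * bp ε = bp ε * bm ε + (ε : ℂ) • 1 := by
    rw [← Algebra.algebraMap_eq_smul_one, ← bm_bp, add_sub_cancel]
  induction q with
  | zero => simpa using h
  | succ q ih =>
    rw [pow_succ, ← mul_assoc, ih, add_mul, mul_assoc, h, mul_add, smul_mul_assoc, ← pow_succ,
      mul_smul_comm, mul_one, ← mul_assoc]
    push_cast
    module

theorem bm_pow_succ_mul_bp (ε : ℝ) (q : ℕ) :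
    bm ε ^ q * bp ε * bm ε = bp ε * bm ε ^ (q + 1) + ((q : ℂ) * ε) • bm ε ^ q := by
  have h : bm ε * bp ε = bp ε * bm ε + (ε : ℂ) • 1 := by
    rw [← Algebra.algebraMap_eq_smul_one, ← bm_bp, add_sub_cancel]
  induction q with
  | zero => simp
  | succ q ih =>
    rw [pow_succ' _ q, mul_assoc (bm ε), mul_assoc (bm ε), ih, mul_add, ← mul_assoc, h, add_mul,
      mul_smul_comm, ← pow_succ', smul_mul_assoc, one_mul, mul_assoc, ← pow_succ']
    push_cast
    module

theorem raise_eq_diagElt (ε : ℝ) (p q : ℕ) :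
    raise ε (am ε ^ (p + 1) * ap ε ^ p * (bp ε ^ (q + 1) * bm ε ^ q)) =
      ((q : ℂ) + 1) • diagElt ε (p + 1) q - ((p : ℂ) + 1) • (diagElt ε p (q + 1) +
        (((q : ℂ) + 1) * ε) • diagElt ε p q) := by
  have hL := isLeibniz_raise ε
  have cab : Commute (am ε) (raise ε (am ε)) := by
    rw [raise_am]; exact (show Commute (am ε) (bm ε) from am_bm ε).neg_right
  have cba : Commute (bp ε) (raise ε (bp ε)) := by
    rw [raise_bp]; exact (show Commute (ap ε) (bp ε) from ap_bp ε).symm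
  have c1 : Commute (bm ε) (ap ε ^ p) := (show Commute (ap ε) (bm ε) from ap_bm ε).symm.pow_right p
  have c2 : Commute (ap ε) (bp ε ^ q) := (show Commute (ap ε) (bp ε) from ap_bp ε).pow_right q
  rw [hL, hL (am ε ^ (p + 1)), hL (bp ε ^ (q + 1)), hL.map_pow_eq_zero (raise_ap ε),
    hL.map_pow_eq_zero (raise_bm ε), hL.map_pow_succ cab, hL.map_pow_succ cba, raise_am, raise_bp]
  have e1 : am ε ^ p * -bm ε * ap ε ^ p * (bp ε ^ (q + 1) * bm ε ^ q) =
      -(diagElt ε p (q + 1) + (((q : ℂ) + 1) * ε) • diagElt ε p q) := by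
    have : am ε ^ p * -bm ε * ap ε ^ p * (bp ε ^ (q + 1) * bm ε ^ q) =
        -(am ε ^ p * ap ε ^ p * (bm ε * bp ε ^ (q + 1)) * bm ε ^ q) := by
      rw [mul_neg, neg_mul, neg_mul, mul_assoc _ (bm ε), c1.eq]
      simp only [mul_assoc]
    rw [this, bm_mul_bp_pow, diagElt, diagElt, pow_succ' (bm ε)]
    simp only [mul_add, add_mul, mul_smul_comm, smul_mul_assoc, mul_assoc]
  have e2 : am ε ^ (p + 1) * ap ε ^ p * (bp ε ^ q * ap ε * bm ε ^ q) = diagElt ε (p + 1) q := by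
    rw [← c2.eq, diagElt, pow_succ (ap ε)]
    simp only [mul_assoc]
  simp only [mul_zero, zero_add, smul_mul_assoc, mul_smul_comm, e1, e2]
  module

theorem diagElt_mul_K0_sub (ε R : ℝ) (p q : ℕ) :
    diagElt ε p q * (K0 ε - algebraMap ℂ (W ε) (Rhat ε R : ℂ)) =
      (1 / 2 : ℂ) • (diagElt ε (p + 1) q + diagElt ε p (q + 1)
        + ((q - p : ℂ) * ε - 2 * Rhat ε R) • diagElt ε p q) := by
  have c1 : Commute (ap ε * am ε) (bp ε ^ q * bm ε ^ q) := by
    have h1 : Commute (ap ε) (bp ε) := ap_bp ε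
    have h2 : Commute (ap ε) (bm ε) := ap_bm ε
    have h3 : Commute (am ε) (bp ε) := am_bp ε
    have h4 : Commute (am ε) (bm ε) := am_bm ε
    exact ((h1.pow_right q).mul_right (h2.pow_right q)).mul_left
      ((h3.pow_right q).mul_right (h4.pow_right q))
  have e1 : diagElt ε p q * (ap ε * am ε) =
      diagElt ε (p + 1) q - (((p : ℂ) + 1) * ε) • diagElt ε p q := by
    have : diagElt ε p q * (ap ε * am ε) =
        am ε ^ p * (ap ε ^ (p + 1) * am ε) * (bp ε ^ q * bm ε ^ q) := by
      rw [diagElt, mul_assoc _ (bp ε ^ q), mul_assoc _ (bp ε ^ q * _), ← c1.eq, pow_succ (ap ε)]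
      simp only [mul_assoc]
    rw [this, eq_sub_of_add_eq (am_mul_ap_pow ε p).symm, diagElt, diagElt, pow_succ (am ε)]
    simp only [mul_sub, sub_mul, mul_smul_comm, smul_mul_assoc, mul_assoc]
  have e2 : diagElt ε p q * (bp ε * bm ε) =
      diagElt ε p (q + 1) + ((q : ℂ) * ε) • diagElt ε p q := by
    have : diagElt ε p q * (bp ε * bm ε) =
        am ε ^ p * ap ε ^ p * bp ε ^ q * (bm ε ^ q * bp ε * bm ε) := by
      rw [diagElt]; simp only [mul_assoc]
    rw [this, bm_pow_succ_mul_bp, diagElt, diagElt, pow_succ (bp ε)]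
    simp only [mul_add, mul_smul_comm, mul_assoc]
  rw [K0, mul_sub, mul_smul_comm, mul_add, mul_add, e1, e2, ← Algebra.commutes,
    ← Algebra.smul_def, ← Algebra.commutes, ← Algebra.smul_def]
  module

/-- This is the vanishing of `π₀ ∘ ρ` on the left ideal generated by `K₀ - R̂`. -/
theorem phi_diagElt_add (ε R : ℝ) (p q : ℕ) :
    phi ε R (diagElt ε (p + 1) q) + phi ε R (diagElt ε p (q + 1)) =
      (2 * Rhat ε R + (p - q : ℂ) * ε) * phi ε R (diagElt ε p q) := by
  have h := phi_mul_K0_sub ε R (diagElt ε p q)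
  rw [diagElt_mul_K0_sub] at h
  simp only [map_smul, map_add, smul_eq_mul] at h
  linear_combination 2 * h

/-- This is the invariance of `π₀ ∘ ρ` under the raising derivation. -/
theorem phi_diagElt_sub (ε R : ℝ) (p q : ℕ) :
    ((q : ℂ) + 1) * phi ε R (diagElt ε (p + 1) q) =
      ((p : ℂ) + 1) * (phi ε R (diagElt ε p (q + 1))
        + ((q : ℂ) + 1) * ε * phi ε R (diagElt ε p q)) := by
  have h := phi_raise ε R (am ε ^ (p + 1) * ap ε ^ p * (bp ε ^ (q + 1) * bm ε ^ q))
  rw [raise_eq_diagElt] at h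
  simp only [map_smul, map_add, map_sub, smul_eq_mul] at h
  linear_combination h

theorem phi_diagElt_succ_left (ε R : ℝ) (p q : ℕ) :
    ((p : ℂ) + q + 2) * phi ε R (diagElt ε (p + 1) q) =
      ((p : ℂ) + 1) * (2 * Rhat ε R + ε * (p + 1)) * phi ε R (diagElt ε p q) := by
  linear_combination ((p : ℂ) + 1) * phi_diagElt_add ε R p q + phi_diagElt_sub ε R p q

theorem phi_diagElt_succ_right (ε R : ℝ) (p q : ℕ) :
    ((p : ℂ) + q + 2) * phi ε R (diagElt ε p (q + 1)) =
      ((q : ℂ) + 1) * (2 * Rhat ε R - ε * (q + 1)) * phi ε R (diagElt ε p q) := by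
  linear_combination ((q : ℂ) + 1) * phi_diagElt_add ε R p q - phi_diagElt_sub ε R p q

/-- The value of `π₀ ∘ ρ` at `a₋^p a₊^p b₊^q b₋^q`. -/
def diagValue (ε R : ℝ) (p q : ℕ) : ℝ :=
  ((p.factorial : ℝ) * (q.factorial : ℝ)) / ((p + q + 1).factorial : ℝ) *
    (∏ s ∈ Finset.Icc 1 q, (2 * Rhat ε R - ε * (s : ℝ))) *
    (∏ s ∈ Finset.Icc 1 p, (2 * Rhat ε R + ε * (s : ℝ)))

theorem diagValue_succ_left (ε R : ℝ) (p q : ℕ) :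
    ((p : ℝ) + q + 2) * diagValue ε R (p + 1) q =
      ((p : ℝ) + 1) * (2 * Rhat ε R + ε * (p + 1)) * diagValue ε R p q := by
  have h : ((p + q + 1).factorial : ℝ) ≠ 0 := Nat.cast_ne_zero.2 (Nat.factorial_ne_zero _)
  have h' : (p : ℝ) + q + 2 ≠ 0 := by positivity
  rw [diagValue, diagValue, Finset.prod_Icc_succ_top (by omega),
    show p + 1 + q + 1 = (p + q + 1) + 1 by ring, Nat.factorial_succ, Nat.factorial_succ]
  push_cast
  rw [show (p : ℝ) + q + 1 + 1 = p + q + 2 by ring]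
  field_simp

theorem diagValue_succ_right (ε R : ℝ) (p q : ℕ) :
    ((p : ℝ) + q + 2) * diagValue ε R p (q + 1) =
      ((q : ℝ) + 1) * (2 * Rhat ε R - ε * (q + 1)) * diagValue ε R p q := by
  have h : ((p + q + 1).factorial : ℝ) ≠ 0 := Nat.cast_ne_zero.2 (Nat.factorial_ne_zero _)
  have h' : (p : ℝ) + q + 2 ≠ 0 := by positivity
  rw [diagValue, diagValue, Finset.prod_Icc_succ_top (by omega),
    show p + (q + 1) + 1 = (p + q + 1) + 1 by ring, Nat.factorial_succ, Nat.factorial_succ]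
  push_cast
  rw [show (p : ℝ) + q + 1 + 1 = p + q + 2 by ring]
  field_simp

theorem phi_diagElt (ε R : ℝ) (p q : ℕ) :
    phi ε R (diagElt ε p q) = (diagValue ε R p q : ℂ) := by
  have h : ∀ p q : ℕ, (p : ℂ) + q + 2 ≠ 0 := fun p q => by
    exact_mod_cast (Nat.succ_ne_zero (p + q + 1))
  induction q with
  | zero =>
    induction p with
    | zero => simp [diagElt, diagValue, phi_one]
    | succ p ih =>
      refine mul_left_cancel₀ (h p 0) ?_
      rw [phi_diagElt_succ_left, ih]
      exact_mod_cast (diagValue_succ_left ε R p 0).symm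
  | succ q ih =>
    refine mul_left_cancel₀ (h p q) ?_
    rw [phi_diagElt_succ_right, ih]
    exact_mod_cast (diagValue_succ_right ε R p q).symm

/-! ### Norms of the lowered vectors -/

/-- The weight derivation `[raise, der]`. -/
def weight (ε : ℝ) : W ε →ₗ[ℂ] W ε := raise ε ∘ₗ der ε - der ε ∘ₗ raise ε

theorem weight_apply (ε : ℝ) (w : W ε) :
    weight ε w = raise ε (der ε w) - der ε (raise ε w) := rfl

theorem isLeibniz_weight (ε : ℝ) : IsLeibniz (weight ε) :=
  (isLeibniz_raise ε).commutator (isLeibniz_der ε)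

theorem weight_ap (ε : ℝ) : weight ε (ap ε) = ap ε := by
  simp [weight_apply, der_ap, raise_ap, raise_bp]

theorem weight_am (ε : ℝ) : weight ε (am ε) = -am ε := by
  simp [weight_apply, der_am, raise_am, der_bm]

theorem weight_bp (ε : ℝ) : weight ε (bp ε) = -bp ε := by
  simp [weight_apply, der_bp, raise_bp, der_ap]

theorem weight_bm (ε : ℝ) : weight ε (bm ε) = bm ε := by
  simp [weight_apply, der_bm, raise_bm, raise_am]

/-- The commutation relation `[weight, der] = -2 der` of `sl₂`. -/
theorem weight_der (ε : ℝ) (w : W ε) :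
    weight ε (der ε w) = der ε (weight ε w) - (2 : ℂ) • der ε w := by
  have h1 := (isLeibniz_weight ε).commutator (isLeibniz_der ε)
  have h2 : IsLeibniz (-(2 : ℂ) • der ε) := fun v w => by
    simp [der_mul]
  have := h1.ext h2 (fun g => by
    cases g
    · change weight ε (der ε (ap ε)) - der ε (weight ε (ap ε)) = -(2 : ℂ) • der ε (ap ε)
      rw [weight_ap, der_ap, weight_bp]
      module
    · change weight ε (der ε (am ε)) - der ε (weight ε (am ε)) = -(2 : ℂ) • der ε (am ε)
      simp [weight_am, der_am]
    · change weight ε (der ε (bp ε)) - der ε (weight ε (bp ε)) = -(2 : ℂ) • der ε (bp ε)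
      simp [weight_bp, der_bp]
    · change weight ε (der ε (bm ε)) - der ε (weight ε (bm ε)) = -(2 : ℂ) • der ε (bm ε)
      rw [weight_bm, der_bm, map_neg, weight_am]
      module) w
  rw [LinearMap.sub_apply, LinearMap.comp_apply, LinearMap.comp_apply, LinearMap.smul_apply,
    sub_eq_iff_eq_add] at this
  rw [this]
  module

/-- The highest weight vector `a₊^p b₋^q`. -/
def topElt (ε : ℝ) (p q : ℕ) : W ε := ap ε ^ p * bm ε ^ q

theorem raise_topElt (ε : ℝ) (p q : ℕ) : raise ε (topElt ε p q) = 0 := by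
  have hL := isLeibniz_raise ε
  rw [topElt, hL, hL.map_pow_eq_zero (raise_ap ε), hL.map_pow_eq_zero (raise_bm ε), mul_zero,
    zero_mul, add_zero]

theorem weight_pow {ε : ℝ} {w : W ε} (h : weight ε w = w) (p : ℕ) :
    weight ε (w ^ p) = (p : ℂ) • w ^ p := by
  induction p with
  | zero => simp [(isLeibniz_weight ε).map_one]
  | succ p ih =>
    rw [pow_succ, isLeibniz_weight, ih, h, smul_mul_assoc]
    push_cast
    module

theorem weight_der_pow_topElt (ε : ℝ) (p q k : ℕ) :
    weight ε ((der ε ^ k) (topElt ε p q)) =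
      ((p : ℂ) + q - 2 * k) • (der ε ^ k) (topElt ε p q) := by
  induction k with
  | zero =>
    rw [pow_zero, Module.End.one_apply, topElt, isLeibniz_weight, weight_pow (weight_ap ε),
      weight_pow (weight_bm ε), smul_mul_assoc, mul_smul_comm]
    push_cast
    module
  | succ k ih =>
    rw [pow_succ', Module.End.mul_apply, weight_der, ih, map_smul]
    push_cast
    module

theorem raise_der_pow_topElt (ε : ℝ) (p q k : ℕ) :
    raise ε ((der ε ^ (k + 1)) (topElt ε p q)) =
      (((k : ℂ) + 1) * (p + q - k)) • (der ε ^ k) (topElt ε p q) := by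
  have key : ∀ w, raise ε (der ε w) = weight ε w + der ε (raise ε w) := fun w => by
    rw [weight_apply, sub_add_cancel]
  induction k with
  | zero =>
    rw [pow_succ', Module.End.mul_apply, key, weight_der_pow_topElt, pow_zero,
      Module.End.one_apply, raise_topElt, map_zero, add_zero]
    congr 1
    push_cast
    ring
  | succ k ih =>
    rw [pow_succ', Module.End.mul_apply, key, weight_der_pow_topElt, ih, map_smul,
      ← Module.End.mul_apply, ← pow_succ', ← add_smul]
    congr 1
    push_cast
    ring

/-- `raise` is adjoint to `der`. -/
theorem phi_dagger_der_mul (ε R : ℝ) (v w : W ε) :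
    phi ε R (dagger ε (der ε v) * w) = phi ε R (dagger ε v * raise ε w) := by
  have h := phi_raise ε R (dagger ε v * w)
  rw [isLeibniz_raise, map_add] at h
  rw [dagger_der, neg_mul, map_neg]
  linear_combination -h

/-- Moving one factor `der` to the other side as `raise` reduces `k` by one. -/
theorem phi_der_pow_topElt (ε R : ℝ) (p q k : ℕ) (hk : k ≤ p + q) :
    phi ε R (dagger ε ((der ε ^ k) (topElt ε p q)) * (der ε ^ k) (topElt ε p q)) =
      (k.factorial * (p + q).descFactorial k : ℕ) * phi ε R (diagElt ε p q) := by
  induction k with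
  | zero =>
    have c : Commute (bp ε ^ q) (am ε ^ p * ap ε ^ p) :=
      (((show Commute (am ε) (bp ε) from am_bp ε).pow_pow p q).mul_left
        ((show Commute (ap ε) (bp ε) from ap_bp ε).pow_pow p q)).symm
    have e : dagger ε (topElt ε p q) * topElt ε p q = diagElt ε p q := by
      rw [topElt, dagger_mul, dagger_pow, dagger_pow, dagger_gen, dagger_gen]
      change bp ε ^ q * am ε ^ p * (ap ε ^ p * bm ε ^ q) = _
      rw [diagElt, ← c.eq]
      simp only [mul_assoc]
    simp [e]
  | succ k ih =>
    have h1 : phi ε R (dagger ε ((der ε ^ (k + 1)) (topElt ε p q)) *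
        (der ε ^ (k + 1)) (topElt ε p q)) = phi ε R (dagger ε ((der ε ^ k) (topElt ε p q)) *
          raise ε ((der ε ^ (k + 1)) (topElt ε p q))) := by
      rw [← phi_dagger_der_mul, ← Module.End.mul_apply (der ε), ← pow_succ']
    rw [h1, raise_der_pow_topElt, mul_smul_comm, map_smul, ih (by omega), smul_eq_mul,
      Nat.factorial_succ, Nat.descFactorial_succ]
    push_cast [Nat.cast_sub (show k ≤ p + q by omega)]
    ring

theorem ite_Ad_pow_eq_der_pow (ε : ℝ) (k : ℕ) (w : W ε) :
    (if ε = 0 then (der ε ^ k) w else (((ε ^ k)⁻¹ : ℝ) : ℂ) • (Ad ε (Jm ε) ^ k) w) =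
      (der ε ^ k) w := by
  split_ifs with h
  · rfl
  · have e : Ad ε (Jm ε) = (ε : ℂ) • der ε := LinearMap.ext fun w => (smul_der ε w).symm
    rw [e, smul_pow, LinearMap.smul_apply, smul_smul]
    push_cast
    rw [inv_mul_cancel₀ (pow_ne_zero _ (Complex.ofReal_ne_zero.2 h)), one_smul]

theorem P_eq {n r m : ℝ} {p q j k : ℕ} (ε : ℝ) (hp : n + r = p) (hq : n - r = q) (hj : n + m = j)
    (hk : n - m = k) : P ε n r m =
      ((Real.sqrt ((j.factorial : ℝ) / (((p + q).factorial : ℝ) * (k.factorial : ℝ))) : ℝ) : ℂ) •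
        (der ε ^ k) (topElt ε p q) := by
  have h2 : 2 * n = ((p + q : ℕ) : ℝ) := by push_cast; linarith
  rw [P, ite_Ad_pow_eq_der_pow, h2, hp, hq, hj, hk]
  simp only [Nat.floor_natCast, topElt]

/-- The normalizing factor of `P(n, r, m)` cancels the factor `k! (2n)! / (2n - k)!` that
`k = n - m` lowerings contribute to the norm. -/
theorem form_P {n r m : ℝ} {p q j k : ℕ} (ε R : ℝ) (hp : n + r = p) (hq : n - r = q)
    (hj : n + m = j) (hk : n - m = k) :
    form ε R (P ε n r m) (P ε n r m) = (diagValue ε R p q : ℂ) := by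
  have hjk : j + k = p + q := by
    have : (j : ℝ) + k = p + q := by linarith
    exact_mod_cast this
  rw [form, pi0_rho_eq, P_eq ε hp hq hj hk, dagger_smul, Complex.conj_ofReal, smul_mul_assoc,
    mul_smul_comm, smul_smul, map_smul, phi_der_pow_topElt ε R p q k (by omega), phi_diagElt,
    smul_eq_mul, ← mul_assoc, ← Complex.ofReal_mul, Real.mul_self_sqrt (by positivity)]
  have h1 : j.factorial * (p + q).descFactorial k = (p + q).factorial := by
    rw [← Nat.factorial_mul_descFactorial (show k ≤ p + q by omega)]
    congr 2
    omega
  have h2 : ((j.factorial : ℝ) / (((p + q).factorial : ℝ) * (k.factorial : ℝ))) *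
      ((k.factorial * (p + q).descFactorial k : ℕ) : ℝ) = 1 := by
    rw [← h1]
    have : ((p + q).descFactorial k : ℝ) ≠ 0 :=
      Nat.cast_ne_zero.2 (Nat.descFactorial_eq_zero_iff_lt.not.2 (by omega))
    push_cast
    field_simp
  rw [← Complex.ofReal_natCast, ← Complex.ofReal_mul, h2, Complex.ofReal_one, one_mul]

/-! ### The sign of the norm -/

theorem prod_two_Rhat_add_pos {ε R : ℝ} (hε : 0 ≤ ε) (hR : 0 < Rhat ε R) (p : ℕ) :
    0 < ∏ s ∈ Finset.Icc 1 p, (2 * Rhat ε R + ε * (s : ℝ)) :=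
  Finset.prod_pos fun s _ => by positivity

theorem sign_diagValue {ε R : ℝ} (hε : 0 ≤ ε) (hR : 0 < Rhat ε R) (p q : ℕ) :
    Real.sign (diagValue ε R p q) =
      Real.sign (∏ s ∈ Finset.Icc 1 q, (2 * Rhat ε R - ε * (s : ℝ))) := by
  have h1 : 0 < ((p.factorial : ℝ) * (q.factorial : ℝ)) / ((p + q + 1).factorial : ℝ) := by
    positivity
  have h2 := prod_two_Rhat_add_pos hε hR p
  rw [diagValue]
  rcases lt_trichotomy (∏ s ∈ Finset.Icc 1 q, (2 * Rhat ε R - ε * (s : ℝ))) 0 with h | h | h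
  · rw [Real.sign_of_neg h, Real.sign_of_neg]
    exact mul_neg_of_neg_of_pos (mul_neg_of_pos_of_neg h1 h) h2
  · rw [h, mul_zero, zero_mul]
  · rw [Real.sign_of_pos h, Real.sign_of_pos]
    positivity

theorem sign_mul_of_neg {x : ℝ} (hx : x < 0) (y : ℝ) : Real.sign (x * y) = -Real.sign y := by
  rcases lt_trichotomy y 0 with h | rfl | h
  · rw [Real.sign_of_neg h, Real.sign_of_pos (mul_pos_of_neg_of_neg hx h), neg_neg]
  · rw [mul_zero, Real.sign_zero, neg_zero]
  · rw [Real.sign_of_pos h, Real.sign_of_neg (mul_neg_of_neg_of_pos hx h)]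

/-- If the factors change from positive to negative after the index `f`, the sign of the product
counts the factors after `f`. -/
theorem sign_prod_sub_mul {x ε : ℝ} (f : ℕ) (h1 : ∀ s ≤ f, 0 < x - ε * (s : ℝ))
    (h2 : ∀ s, f < s → x - ε * (s : ℝ) < 0) {q : ℕ} (hq : f ≤ q) :
    Real.sign (∏ s ∈ Finset.Icc 1 q, (x - ε * (s : ℝ))) = (-1) ^ (q - f) := by
  induction q, hq using Nat.le_induction with
  | base =>
    rw [Nat.sub_self, pow_zero]
    exact Real.sign_of_pos (Finset.prod_pos fun s hs => h1 s (Finset.mem_Icc.1 hs).2)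
  | succ q hq ih =>
    rw [Finset.prod_Icc_succ_top (by omega), mul_comm,
      sign_mul_of_neg (h2 _ (by omega)), ih, Nat.sub_add_comm hq, pow_succ', neg_one_mul]

end JordanSchwinger

end

open JordanSchwinger in
theorem mainTheorem2 (ε R : ℝ) (hR : 0 ≤ R) (hRhat : 0 < Rhat ε R)
    (n r m : ℝ) (hn : ∃ k : ℤ, 2 * n = k) (hr : ∃ k : ℤ, n + r = k) (hm : ∃ k : ℤ, n + m = k)
    (hn0 : 0 ≤ n) (hrn : |r| ≤ n) (hmn : |m| ≤ n) :
    form ε R (P ε n r m) (P ε n r m) = (normSq ε R (P ε n r m) : ℂ) ∧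
    (normSq ε R (P ε n r m) : ℂ) =
      pi0 ε (rho ε R (am ε ^ ⌊n + r⌋₊ * ap ε ^ ⌊n + r⌋₊ * bp ε ^ ⌊n - r⌋₊ * bm ε ^ ⌊n - r⌋₊)) ∧
    normSq ε R (P ε n r m) =
      ((⌊n + r⌋₊.factorial : ℝ) * (⌊n - r⌋₊.factorial : ℝ)) / ((⌊2 * n⌋₊ + 1).factorial : ℝ) *
        (∏ s ∈ Finset.Icc 1 ⌊n - r⌋₊, (2 * Rhat ε R - ε * (s : ℝ))) *
        (∏ s ∈ Finset.Icc 1 ⌊n + r⌋₊, (2 * Rhat ε R + ε * (s : ℝ))) ∧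
    ((ε = 0 ∨ n - r < 2 * Rhat ε R / ε) → Real.sign (normSq ε R (P ε n r m)) = 1) ∧
    (ε ≠ 0 → (∃ k : ℤ, 2 * Rhat ε R / ε = k) → 1 ≤ 2 * Rhat ε R / ε → 2 * Rhat ε R / ε ≤ n - r →
      Real.sign (normSq ε R (P ε n r m)) = 0) ∧
    (ε ≠ 0 → (¬ ∃ k : ℤ, 2 * Rhat ε R / ε = k) → 0 < 2 * Rhat ε R / ε → 2 * Rhat ε R / ε < n - r →
      Real.sign (normSq ε R (P ε n r m)) = (-1) ^ (⌊n - r⌋ - ⌊2 * Rhat ε R / ε⌋)) := by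
  have toNat : ∀ x : ℝ, (∃ k : ℤ, x = k) → 0 ≤ x → ∃ k : ℕ, x = k := by
    rintro x ⟨k, rfl⟩ hx
    obtain ⟨l, rfl⟩ := Int.eq_ofNat_of_zero_le (Int.cast_nonneg_iff.1 hx)
    exact ⟨l, by simp⟩
  obtain ⟨hr1, hr2⟩ := abs_le.1 hrn
  obtain ⟨hm1, hm2⟩ := abs_le.1 hmn
  obtain ⟨N, hN⟩ := hn
  have sub_int : ∀ t : ℝ, (∃ k : ℤ, n + t = k) → ∃ k : ℤ, n - t = k := by
    rintro t ⟨k, hk⟩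
    exact ⟨N - k, by push_cast; linarith⟩
  obtain ⟨p, hp⟩ := toNat _ hr (by linarith)
  obtain ⟨q, hq⟩ := toNat _ (sub_int r hr) (by linarith)
  obtain ⟨j, hj⟩ := toNat _ hm (by linarith)
  obtain ⟨k, hk⟩ := toNat _ (sub_int m hm) (by linarith)
  have h2n : 2 * n = ((p + q : ℕ) : ℝ) := by push_cast; linarith
  have hform := form_P ε R hp hq hj hk
  have hnorm : normSq ε R (P ε n r m) = diagValue ε R p q := by
    rw [normSq, hform, Complex.ofReal_re]
  -- `2R̂ / ε` is positive only for positive `ε`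
  have hpos : 0 < 2 * Rhat ε R / ε → 0 < ε := fun h => by
    by_contra hε
    exact absurd h (not_lt.2 (div_nonpos_of_nonneg_of_nonpos (by positivity) (not_lt.1 hε)))
  rw [hnorm, hp, hq, h2n]
  simp only [Nat.floor_natCast, Int.floor_natCast]
  refine ⟨hform, ?_, rfl, ?_, ?_, ?_⟩
  · rw [pi0_rho_eq]
    exact (phi_diagElt ε R p q).symm
  · intro h
    rcases h with rfl | h
    · rw [sign_diagValue le_rfl hRhat, Real.sign_of_pos]
      exact Finset.prod_pos fun s _ => by simpa using hRhat
    · have hε := hpos ((Nat.cast_nonneg q).trans_lt h)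
      rw [lt_div_iff₀ hε] at h
      rw [sign_diagValue hε.le hRhat, Real.sign_of_pos]
      refine Finset.prod_pos fun s hs => ?_
      have hs' : (s : ℝ) ≤ q := Nat.cast_le.2 (Finset.mem_Icc.1 hs).2
      nlinarith
  · rintro - hint h1 hle
    have hε := hpos (by linarith)
    obtain ⟨s, hs⟩ := toNat _ hint (by linarith)
    rw [hs] at h1 hle
    rw [sign_diagValue hε.le hRhat, Finset.prod_eq_zero (i := s), Real.sign_zero]
    · exact Finset.mem_Icc.2 ⟨by exact_mod_cast h1, by exact_mod_cast hle⟩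
    · rw [← hs]
      field_simp
      ring
  · rintro - hint h0 hlt
    have hε := hpos h0
    have hf : ⌊2 * Rhat ε R / ε⌋ = (⌊2 * Rhat ε R / ε⌋₊ : ℤ) :=
      (Int.natCast_floor_eq_floor h0.le).symm
    have hfq : ⌊2 * Rhat ε R / ε⌋₊ ≤ q := Nat.floor_le_of_le hlt.le
    rw [sign_diagValue hε.le hRhat, sign_prod_sub_mul ⌊2 * Rhat ε R / ε⌋₊ _ _ hfq, hf,
      ← Nat.cast_sub hfq, zpow_natCast]
    · intro s hs
      have h1 : (s : ℝ) ≤ 2 * Rhat ε R / ε := (Nat.le_floor_iff h0.le).1 hs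
      have h2 : (s : ℝ) < 2 * Rhat ε R / ε :=
        lt_of_le_of_ne h1 fun e => hint ⟨s, by rw [← e]; simp⟩
      rw [lt_div_iff₀ hε] at h2
      linarith
    · intro s hs
      have h1 : 2 * Rhat ε R / ε < s := (Nat.floor_lt h0.le).1 hs
      rw [div_lt_iff₀ hε] at h1
      linarith
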